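/- Let $G$ be a (Hausdorff) topological group that is separable and metrisable. A metric $d$ on $G$ is compatible if it induces the topology of $G$, and left-invariant if $d(gx,gy)=d(x,y)$ for all $g,x,y\in G$. A sequence $(g_n)$ in $G$ tends to infinity, $g_n\to\infty$, if $d(g_n,1)\to\infty$ for some compatible left-invariant metric $d$ on $G$; a compatible left-invariant metric $d$ is metrically proper if $d(g_n,1)\to\infty$ whenever $g_n\to\infty$. The group $G$ has the local property (OB) if some neighbourhood of $1$ has finite diameter with respect to every compatible left-invariant metric on $G$; for separable metrisable $G$ this holds if and only if $G$ has a metrically proper compatible left-invariant metric. The group $G$ is approximately compact if there is a chain $K_0\leqslant K_1\leqslant\cdots\leqslant G$ of compact subgroups whose union is dense in $G$. A map $F\colon (X,d_X)\to (Y,d_Y)$ between metric spaces is a coarse embedding if $\kappa_1(t)=\inf\{d_Y(Fx_1,Fx_2) : d_X(x_1,x_2)\geqslant t\}$ tends to $\infty$ as $t\to\infty$ and $\kappa_2(t)=\sup\{d_Y(Fx_1,Fx_2) : d_X(x_1,x_2)\leqslant t\}$ is finite for every $t\geqslant 0$. For a group $G$ with the local property (OB) as above, a map $\sigma$ from $G$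 to a Banach space $E$ is a uniformly continuous coarse embedding if it is one as a map $(G,d)\to E$ for the metrically proper compatible left-invariant metrics $d$ on $G$ (whether this holds does not depend on the choice of $d$). Let $(\epsilon_i)$ be independent random variables with $\mathbb P(\epsilon_i=1)=\mathbb P(\epsilon_i=-1)=\frac12$. A real Banach space $X$ has type $p\in[1,2]$ if there is a constant $C$ with $$\Big(\mathbb E\Big\|\sum_{i=1}^n\epsilon_ix_i\Big\|^p\Big)^{1/p}\leqslant C\Big(\sum_{i=1}^n\|x_i\|^p\Big)^{1/p}$$ for all finite sequences $x_1,\dots,x_n\in X$, and cotype $q\in[2,\infty)$ if there is a constant $K$ with $$\Big(\sum_{i=1}^n\|x_i\|^q\Big)^{1/q}\leqslant K\Big(\mathbb E\Big\|\sum_{i=1}^n\epsilon_ix_i\Big\|^q\Big)^{1/q}$$ for all such sequences; by convention, every Banach space has cotype $\infty$. Theorem. Let $1\leqslant p\leqslant 2\leqslant q\leqslant\infty$ and let $G$ be an approximately compact separable metrisable group with the local property (OB). Suppose that $G$ admits a uniformly continuous coarse embedding into a Banach space $E$ of type $p$ and cotype $q$. Then there are a Banach space $V$ of type $p$ and cotype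 $q$ and an action $\alpha$ of $G$ on $V$ by surjective affine isometries which is continuous (that is, $(g,x)\mapsto\alpha(g)x$ is continuous from $G\times V$ to $V$) and metrically proper (that is, for every $x\in V$, $\|\alpha(g_n)x-x\|\to\infty$ whenever $g_n\to\infty$ in $G$). -/

import Mathlib

open Filter Topology
open scoped NNReal ENNReal

universe u v

/-- A metric `m` on the topological group `G` is compatible (it induces the given topology of `G`)
and left-invariant. -/
structure IsCompatibleLeftInvariant {G : Type*} [Group G] [t : TopologicalSpace G]
    (m : MetricSpace G) : Prop where
  compatible : m.toPseudoMetricSpace.toUniformSpace.toTopologicalSpace = t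
  left_invariant : ∀ g x y : G, m.dist (g * x) (g * y) = m.dist x y

/-- `A` has property (OB) relative to `G`: it has finite diameter with respect to every compatible
left-invariant metric on `G`. -/
def HasRelativeOB {G : Type*} [Group G] [TopologicalSpace G] (A : Set G) : Prop :=
  ∀ m : MetricSpace G, IsCompatibleLeftInvariant m →
    ∃ R : ℝ, ∀ x ∈ A, ∀ y ∈ A, m.dist x y ≤ R

/-- The local property (OB): some neighbourhood of `1` has property (OB) relative to `G`. -/
def HasLocalOB (G : Type*) [Group G] [TopologicalSpace G] : Prop :=
  ∃ U ∈ 𝓝 (1 : G), HasRelativeOB U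

/-- `G` is approximately compact: there is a countable chain of compact subgroups whose union is
dense in `G`. -/
def IsApproximatelyCompact (G : Type*) [Group G] [TopologicalSpace G] : Prop :=
  ∃ K : ℕ → Subgroup G, Monotone K ∧ (∀ n, IsCompact (K n : Set G)) ∧
    Dense (⋃ n, (K n : Set G))

/-- The sequence `g` tends to infinity in `G`: `d(gₙ, 1) → ∞` for some compatible left-invariant
metric `d` on `G`. -/
def TendsToInfinity {G : Type*} [Group G] [TopologicalSpace G] (g : ℕ → G) : Prop :=
  ∃ m : MetricSpace G, IsCompatibleLeftInvariant m ∧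
    Tendsto (fun n => m.dist (g n) 1) atTop atTop

/-- `m` is a metrically proper compatible left-invariant metric on `G`: `d(gₙ, 1) → ∞` whenever
`gₙ → ∞` in `G`. -/
structure IsMetricallyProperMetric {G : Type*} [Group G] [TopologicalSpace G]
    (m : MetricSpace G) : Prop extends IsCompatibleLeftInvariant m where
  metrically_proper : ∀ g : ℕ → G, TendsToInfinity g →
    Tendsto (fun n => m.dist (g n) 1) atTop atTop

section Moduli

variable {X Y : Type*} [PseudoMetricSpace X] [PseudoMetricSpace Y]

/-- The compression modulus `κ₁(t) = inf { d(F x₁, F x₂) | d(x₁, x₂) ≥ t }`, with values in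
`[0, ∞]`. -/
noncomputable def compressionModulus (F : X → Y) (t : ℝ≥0) : ℝ≥0∞ :=
  ⨅ (x₁ : X) (x₂ : X) (_ : t ≤ nndist x₁ x₂), edist (F x₁) (F x₂)

/-- The expansion modulus `κ₂(t) = sup { d(F x₁, F x₂) | d(x₁, x₂) ≤ t }`, with values in
`[0, ∞]`. -/
noncomputable def expansionModulus (F : X → Y) (t : ℝ≥0) : ℝ≥0∞ :=
  ⨆ (x₁ : X) (x₂ : X) (_ : nndist x₁ x₂ ≤ t), edist (F x₁) (F x₂)

/-- `F` is expanding: `κ₁(t) → ∞` as `t → ∞`. -/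
def IsExpanding (F : X → Y) : Prop :=
  Tendsto (compressionModulus F) atTop (𝓝 ⊤)

/-- `F` is bornologous: `κ₂(t) < ∞` for all `t`. -/
def IsBornologous (F : X → Y) : Prop :=
  ∀ t : ℝ≥0, expansionModulus F t < ⊤

/-- A coarse embedding is a map which is both expanding and bornologous. -/
def IsCoarseEmbedding (F : X → Y) : Prop :=
  IsExpanding F ∧ IsBornologous F

end Moduli

/-- With the group `G` metrised by `m`, the map `σ : (G, m) → Y` is a uniformly continuous coarse
embedding. -/
def IsUCCoarseEmbeddingFor {G Y : Type*} [PseudoMetricSpace Y] (m : MetricSpace G)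
    (σ : G → Y) : Prop :=
  @UniformContinuous G Y m.toPseudoMetricSpace.toUniformSpace _ σ ∧
    @IsCoarseEmbedding G Y m.toPseudoMetricSpace _ σ

/-- `σ : G → Y` is a uniformly continuous coarse embedding of the group `G`, i.e. it is one for the
metrically proper compatible left-invariant metrics on `G`. For groups carrying such metrics (these
are the groups with the local property (OB), when `G` is separable metrisable) one may equivalently
test a single such metric: see `isUCCoarseEmbedding_iff`. -/
def IsUCCoarseEmbedding {G Y : Type*} [Group G] [TopologicalSpace G] [PseudoMetricSpace Y]
    (σ : G → Y) : Prop :=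
  ∀ m : MetricSpace G, IsMetricallyProperMetric m → IsUCCoarseEmbeddingFor m σ

/-- For a metrically proper `m`, every compatible left-invariant metric is bounded on `m`-bounded
distances. -/
theorem IsMetricallyProperMetric.exists_bound {G : Type*} [Group G] [TopologicalSpace G]
    {m m' : MetricSpace G} (h : IsMetricallyProperMetric m) (h' : IsCompatibleLeftInvariant m')
    (R : ℝ≥0) : ∃ S : ℝ≥0, ∀ x y : G, m.dist x y ≤ R → m'.dist x y ≤ S := by
  by_contra! hc
  choose x y hxy hxy' using fun n : ℕ => hc (n : ℝ≥0)
  have e : ∀ n, m.dist ((y n)⁻¹ * x n) 1 = m.dist (x n) (y n) := fun n => by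
    have := h.left_invariant (y n)⁻¹ (x n) (y n)
    rwa [inv_mul_cancel] at this
  have e' : ∀ n, m'.dist ((y n)⁻¹ * x n) 1 = m'.dist (x n) (y n) := fun n => by
    have := h'.left_invariant (y n)⁻¹ (x n) (y n)
    rwa [inv_mul_cancel] at this
  have hinf : TendsToInfinity fun n => (y n)⁻¹ * x n := by
    refine ⟨m', h', tendsto_atTop_mono (fun n => ?_) tendsto_natCast_atTop_atTop⟩
    rw [e']
    exact_mod_cast (hxy' n).le
  obtain ⟨n, hn⟩ := ((h.metrically_proper _ hinf).eventually_gt_atTop (R : ℝ)).exists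
  rw [e] at hn
  exact absurd (hxy n) (not_le.mpr hn)

/-- Being a uniformly continuous coarse embedding does not depend on the choice of a metrically
proper compatible left-invariant metric. -/
theorem isUCCoarseEmbedding_iff {G Y : Type*} [Group G] [TopologicalSpace G]
    [PseudoMetricSpace Y] (σ : G → Y) {m : MetricSpace G} (hm : IsMetricallyProperMetric m) :
    IsUCCoarseEmbedding σ ↔ IsUCCoarseEmbeddingFor m σ := by
  refine ⟨fun h => h m hm, fun h m' hm' => ⟨?_, ?_, ?_⟩⟩
  · rw [@Metric.uniformContinuous_iff G Y m'.toPseudoMetricSpace]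
    intro ε hε
    obtain ⟨δ, hδ, hσ⟩ := (@Metric.uniformContinuous_iff G Y m.toPseudoMetricSpace _ _).1 h.1 ε hε
    have h1 : {g : G | m.dist g 1 < δ} ∈ 𝓝 (1 : G) := by
      have := @Metric.ball_mem_nhds G m.toPseudoMetricSpace 1 δ hδ
      rwa [hm.compatible] at this
    rw [← hm'.compatible] at h1
    obtain ⟨δ', hδ', hsub⟩ := (@Metric.mem_nhds_iff G m'.toPseudoMetricSpace _ _).1 h1
    refine ⟨δ', hδ', fun {a b} hab => hσ ?_⟩
    have e := hm.left_invariant b⁻¹ a b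
    have e' := hm'.left_invariant b⁻¹ a b
    rw [inv_mul_cancel] at e e'
    rw [← e]
    exact hsub (show m'.dist (b⁻¹ * a) 1 < δ' from e'.trans_lt hab)
  · have h2 := h.2.1
    unfold IsExpanding at h2 ⊢
    rw [ENNReal.tendsto_nhds_top_iff_nnreal] at h2 ⊢
    intro c
    obtain ⟨s, hs⟩ := (h2 c).exists
    obtain ⟨S, hS⟩ := hm.exists_bound hm'.toIsCompatibleLeftInvariant s
    filter_upwards [eventually_gt_atTop S] with t ht
    refine hs.trans_le (le_iInf fun x => le_iInf fun y => le_iInf fun hxy => ?_)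
    refine iInf_le_of_le x (iInf_le_of_le y (iInf_le_of_le ?_ le_rfl))
    by_contra hlt
    have h3 : m'.dist x y ≤ S := hS x y (show m.dist x y ≤ s from (not_le.1 hlt).le)
    have h4 : (t : ℝ) ≤ m'.dist x y := hxy
    have h5 : (S : ℝ) < t := ht
    linarith
  · intro t
    obtain ⟨S, hS⟩ := hm'.exists_bound hm.toIsCompatibleLeftInvariant t
    refine lt_of_le_of_lt (iSup_le fun x => iSup_le fun y => iSup_le fun hxy => ?_) (h.2.2 S)
    exact le_iSup_of_le x (le_iSup_of_le y (le_iSup_of_le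
      (show m.dist x y ≤ S from hS x y hxy) le_rfl))

/-- The `r`-th moment `𝔼 ‖∑ εᵢ xᵢ‖ ^ r`, where `(ε₁, …, εₙ)` is uniformly distributed on
`{-1, 1}ⁿ`, i.e. the `εᵢ` are independent Rademacher random variables. -/
noncomputable def rademacherMoment {X : Type*} [NormedAddCommGroup X] [NormedSpace ℝ X] (r : ℝ)
    {n : ℕ} (x : Fin n → X) : ℝ :=
  (2 ^ n)⁻¹ * ∑ ε : Fin n → ℤˣ, ‖∑ i, ((ε i : ℤ) : ℝ) • x i‖ ^ r

/-- `X` has Rademacher type `p`. -/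
def HasRademacherType (X : Type*) [NormedAddCommGroup X] [NormedSpace ℝ X] (p : ℝ) : Prop :=
  ∃ C : ℝ, ∀ (n : ℕ) (x : Fin n → X),
    rademacherMoment p x ^ (1 / p) ≤ C * (∑ i, ‖x i‖ ^ p) ^ (1 / p)

/-- `X` has Rademacher cotype `q`; by convention every space has cotype `∞`. -/
def HasRademacherCotype (X : Type*) [NormedAddCommGroup X] [NormedSpace ℝ X] (q : ℝ≥0∞) : Prop :=
  q = ⊤ ∨ ∃ K : ℝ, ∀ (n : ℕ) (x : Fin n → X),
    (∑ i, ‖x i‖ ^ q.toReal) ^ (1 / q.toReal) ≤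
      K * rademacherMoment q.toReal x ^ (1 / q.toReal)

/-- An action of `G` on `V` by affine isometries is continuous if the map `G × V → V` is. -/
def IsContinuousAffineAction {G V : Type*} [Group G] [TopologicalSpace G] [NormedAddCommGroup V]
    [NormedSpace ℝ V] (α : G →* (V ≃ᵃⁱ[ℝ] V)) : Prop :=
  Continuous fun z : G × V => α z.1 z.2

/-- An action of `G` on `V` by affine isometries is metrically proper if, for all `x`,
`d(gₙ x, x) → ∞` whenever `gₙ → ∞` in `G`. -/
def IsMetricallyProperAffineAction {G V : Type*} [Group G] [TopologicalSpace G]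
    [NormedAddCommGroup V] [NormedSpace ℝ V] (α : G →* (V ≃ᵃⁱ[ℝ] V)) : Prop :=
  ∀ (x : V) (g : ℕ → G), TendsToInfinity g →
    Tendsto (fun n => dist (α (g n) x) x) atTop atTop

/-! Write `R_h F (x) = F (x h)`. The cocycle `b h (x) = σ (x h) - σ x` is formally the coboundary of
`σ`, so `F ↦ R_h F + b h` defines an affine action of `G` on functions `G → E`. The metric is
left-invariant, so `d (x h, x) = d (h, 1)` for all `x`: hence `b h` is bounded, `‖b h (x)‖` is
uniformly small for `h` near `1`, and it is uniformly large in `x` when `h` is far from `1`. The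
action therefore lives on `boundedUniform G E`, and any `G`-invariant seminorm lying between the
infimum and the supremum of `‖F x‖` makes it isometric, continuous and metrically proper.

Such a seminorm, with the geometry of `E`, comes from approximate compactness
(`exists_invariant_seminorm`): take the `Lᵖ`-seminorms for Haar probability measures on the
subgroups `K n` and pass to an ultralimit. It is invariant under each `K n`, hence under `G` by
density. Type `p` and cotype `q` pass from `E` to `Lᵖ(μ, E)` with constants independent of `μ`
(`exists_type_lpNorm`, `exists_cotype_lpNorm`), so they survive the ultralimit and the completion.
Cotype needs `kahane_inequality`, proved here through hypercontractivity.

The hypothesis on `σ` concerns metrically proper metrics; `exists_isMetricallyProperMetric` supplies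
one. -/

section ProperMetric

/-! ### Metrically proper metrics from the local property (OB). -/

variable {G : Type*}

/-- The dyadic gauge of a family of sets `V n`, `n : ℤ`: the infimum of the `2 ^ n` with
`g ∈ V n`. -/
noncomputable def dyadicGauge (V : ℤ → Set G) (g : G) : ℝ≥0 :=
  sInf ((fun n : ℤ => (2 : ℝ≥0) ^ n) '' {n | g ∈ V n})

theorem dyadicGauge_le {V : ℤ → Set G} {g : G} {n : ℤ} (h : g ∈ V n) :
    dyadicGauge V g ≤ 2 ^ n :=
  csInf_le (OrderBot.bddBelow _) ⟨n, h, rfl⟩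

theorem exists_of_dyadicGauge_lt {V : ℤ → Set G} {g : G} (hg : ∃ n, g ∈ V n) {t : ℝ≥0}
    (h : dyadicGauge V g < t) : ∃ n : ℤ, g ∈ V n ∧ (2 : ℝ≥0) ^ n < t := by
  obtain ⟨n, hn⟩ := hg
  obtain ⟨_, ⟨k, hk, rfl⟩, hlt⟩ := exists_lt_of_csInf_lt (Set.Nonempty.image _ ⟨n, hn⟩) h
  exact ⟨k, hk, hlt⟩

/-- Gauge values are compared with integer powers of `2`, so a loss of a factor `2` costs nothing:
an index `k` with `2 ^ k < 2 ^ (n + 1)` satisfies `k ≤ n`. -/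
theorem mem_of_dyadicGauge_lt {V : ℤ → Set G} (hmono : Monotone V) {g : G} (hg : ∃ n, g ∈ V n)
    {n : ℤ} (h : dyadicGauge V g < 2 ^ (n + 1)) : g ∈ V n := by
  obtain ⟨k, hk, hlt⟩ := exists_of_dyadicGauge_lt hg h
  have : k < n + 1 := (zpow_lt_zpow_iff_right₀ (by norm_num : (1 : ℝ≥0) < 2)).1 hlt
  exact hmono (by omega) hk

variable [Group G]

/-- All three factors lie in the set of largest index, and cubing raises that index by one, which
doubles the gauge. This is the relaxed four-point inequality needed to replace the gauge by a metric
built from chains. -/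
theorem dyadicGauge_mul_mul_le {V : ℤ → Set G} (hmono : Monotone V) (hcov : ∀ g, ∃ n, g ∈ V n)
    (hcube : ∀ n, ∀ a ∈ V n, ∀ b ∈ V n, ∀ c ∈ V n, a * b * c ∈ V (n + 1)) (a b c : G) :
    dyadicGauge V (a * b * c) ≤
      2 * max (dyadicGauge V a) (max (dyadicGauge V b) (dyadicGauge V c)) := by
  refine le_of_forall_gt_imp_ge_of_dense fun s hs => ?_
  have hs' : max (dyadicGauge V a) (max (dyadicGauge V b) (dyadicGauge V c)) < s / 2 := by
    rwa [lt_div_iff₀' (by norm_num)]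
  simp only [max_lt_iff] at hs'
  obtain ⟨i, hi, hi'⟩ := exists_of_dyadicGauge_lt (hcov a) hs'.1
  obtain ⟨j, hj, hj'⟩ := exists_of_dyadicGauge_lt (hcov b) hs'.2.1
  obtain ⟨k, hk, hk'⟩ := exists_of_dyadicGauge_lt (hcov c) hs'.2.2
  have key : ∀ n : ℤ, i ≤ n → j ≤ n → k ≤ n → (2 : ℝ≥0) ^ n < s / 2 →
      dyadicGauge V (a * b * c) ≤ s := by
    intro n h1 h2 h3 h4
    refine (dyadicGauge_le
      (hcube n a (hmono h1 hi) b (hmono h2 hj) c (hmono h3 hk))).trans ?_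
    rw [zpow_add₀ two_ne_zero, zpow_one, ← le_div_iff₀ (by norm_num)]
    exact h4.le
  rcases le_total i j with h1 | h1 <;> rcases le_total j k with h2 | h2 <;>
    rcases le_total i k with h3 | h3
  · exact key k (by omega) (by omega) (by omega) hk'
  · exact key i (by omega) (by omega) (by omega) hi'
  · exact key j (by omega) (by omega) (by omega) hj'
  · exact key j (by omega) (by omega) (by omega) hj'
  · exact key k (by omega) (by omega) (by omega) hk'
  · exact key i (by omega) (by omega) (by omega) hi'
  · exact key i (by omega) (by omega) (by omega) hi'
  · exact key i (by omega) (by omega) (by omega) hi'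

theorem exists_zpow_two_lt {ε : ℝ} (hε : 0 < ε) : ∃ n : ℤ, (2 : ℝ) ^ n < ε := by
  obtain ⟨n, hn⟩ := exists_pow_lt_of_lt_one hε (by norm_num : (1 / 2 : ℝ) < 1)
  exact ⟨-n, by simpa using hn⟩

variable [TopologicalSpace G] [IsTopologicalGroup G]

/-- Birkhoff–Kakutani metrisation along a two-sided chain of neighbourhoods of the identity. -/
theorem exists_compatible_leftInvariant_metric [T1Space G] {V : ℤ → Set G}
    (hmono : Monotone V) (hcov : ∀ g, ∃ n, g ∈ V n) (hinv : ∀ n, ∀ a ∈ V n, a⁻¹ ∈ V n)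
    (hcube : ∀ n, ∀ a ∈ V n, ∀ b ∈ V n, ∀ c ∈ V n, a * b * c ∈ V (n + 1))
    (hnhds : ∀ n, V n ∈ 𝓝 (1 : G)) (hbasis : ∀ U ∈ 𝓝 (1 : G), ∃ n, V n ⊆ U) :
    ∃ m : MetricSpace G, IsCompatibleLeftInvariant m ∧
      ∀ (n : ℤ) (g : G), m.dist g 1 < 2 ^ n → g ∈ V n := by
  set ρ := dyadicGauge V
  have hρ1 : ρ 1 = 0 := by
    refine le_antisymm (le_of_forall_pos_le_add fun ε hε => ?_) bot_le
    obtain ⟨n, hn⟩ := exists_zpow_two_lt (show (0 : ℝ) < ε from hε)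
    rw [zero_add]
    exact (dyadicGauge_le (mem_of_mem_nhds (hnhds n))).trans (by exact_mod_cast hn.le)
  have hρinv : ∀ g, ρ g⁻¹ = ρ g := by
    intro g
    have : {n | g⁻¹ ∈ V n} = {n | g ∈ V n} := by
      ext n
      exact ⟨fun h => by simpa using hinv n _ h, hinv n _⟩
    simp only [ρ, dyadicGauge, this]
  set d : G → G → ℝ≥0 := fun x y => ρ (x⁻¹ * y)
  have dself : ∀ x, d x x = 0 := fun x => by simp [d, hρ1]
  have dcomm : ∀ x y, d x y = d y x := fun x y => by
    simp only [d]
    rw [← hρinv, mul_inv_rev, inv_inv]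
  let m₀ := PseudoMetricSpace.ofPreNNDist d dself dcomm
  have hle : ∀ x y, m₀.dist x y ≤ d x y := PseudoMetricSpace.dist_ofPreNNDist_le d dself dcomm
  have hge : ∀ x y, (d x y : ℝ) ≤ 2 * m₀.dist x y := by
    refine PseudoMetricSpace.le_two_mul_dist_ofPreNNDist d dself dcomm fun a b c e => ?_
    have := dyadicGauge_mul_mul_le hmono hcov hcube (a⁻¹ * b) (b⁻¹ * c) (c⁻¹ * e)
    simpa [d, ρ, mul_assoc] using this
  -- The chain metric satisfies `m₀ ≤ d ≤ 2 m₀`; the factor `2` is absorbed by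
  -- `mem_of_dyadicGauge_lt`.
  have hball : ∀ (n : ℤ) (x y : G), m₀.dist x y < 2 ^ n → x⁻¹ * y ∈ V n := by
    intro n x y h
    refine mem_of_dyadicGauge_lt hmono (hcov _) ?_
    have h1 := hge x y
    have h2 : (d x y : ℝ) < 2 ^ (n + 1) := by
      rw [zpow_add₀ two_ne_zero, zpow_one]
      linarith
    exact_mod_cast h2
  have hleft : ∀ g x y, m₀.dist (g * x) (g * y) = m₀.dist x y := by
    intro g x y
    -- The distance is the infimum over chains of the sum of `d` along the chain. Left translation
    -- permutes the chains and preserves `d`.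
    change ((⨅ l : List G, ((g * x :: l).zipWith d (l ++ [g * y])).sum : ℝ≥0) : ℝ) =
      ((⨅ l : List G, ((x :: l).zipWith d (l ++ [y])).sum : ℝ≥0) : ℝ)
    congr 1
    refine ((List.map_surjective_iff.2 (mul_left_surjective g)).iInf_congr _ fun l => ?_).symm
    have e1 : g * x :: l.map (g * ·) = (x :: l).map (g * ·) := rfl
    have e2 : l.map (g * ·) ++ [g * y] = (l ++ [y]).map (g * ·) := by simp
    rw [e1, e2, List.zipWith_map]
    congr 2
    ext a b
    simp [d, mul_assoc]
  let m : MetricSpace G :=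
    { m₀ with
      eq_of_dist_eq_zero := by
        intro x y hxy
        by_contra hne
        have h1 : x⁻¹ * y ≠ 1 := fun h => hne (inv_mul_eq_one.1 h)
        obtain ⟨n, hn⟩ := hbasis _ (isOpen_ne.mem_nhds h1.symm)
        have hxy' : m₀.dist x y = 0 := hxy
        exact hn (hball n x y (by rw [hxy']; positivity)) rfl }
  refine ⟨m, ⟨?_, hleft⟩, ?_⟩
  · refine TopologicalSpace.ext_nhds fun x => ?_
    have hx : ∀ s : Set G, s ∈ 𝓝 x ↔ ∃ n, ∀ y, x⁻¹ * y ∈ V n → y ∈ s := by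
      intro s
      constructor
      · intro hs
        have h1 : (fun y => x * y) ⁻¹' s ∈ 𝓝 (1 : G) :=
          (continuous_const_mul x).continuousAt.preimage_mem_nhds (by simpa using hs)
        obtain ⟨n, hn⟩ := hbasis _ h1
        exact ⟨n, fun y hy => by simpa using hn hy⟩
      · rintro ⟨n, hn⟩
        have h1 : (fun y => x⁻¹ * y) ⁻¹' V n ∈ 𝓝 x :=
          (continuous_const_mul x⁻¹).continuousAt.preimage_mem_nhds (by simpa using hnhds n)
        exact mem_of_superset h1 hn
    ext s
    rw [hx s]
    refine (@Metric.mem_nhds_iff G m₀ x s).trans ⟨?_, ?_⟩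
    · rintro ⟨ε, hε, hs⟩
      obtain ⟨n, hn⟩ := exists_zpow_two_lt hε
      refine ⟨n, fun y hy => hs ?_⟩
      refine (hle y x).trans_lt (lt_of_le_of_lt ?_ hn)
      rw [dcomm]
      exact_mod_cast dyadicGauge_le hy
    · rintro ⟨n, hn⟩
      refine ⟨2 ^ n, by positivity, fun y hy => hn y (hball n x y ?_)⟩
      rw [m₀.dist_comm]
      exact hy
  · intro n g hg
    have := hball n g 1 hg
    simpa using hinv n _ this

/-- Having finite diameter for every compatible left-invariant metric, for sets seen from `1`. -/
theorem HasRelativeOB.dist_one_le {G : Type*} [Group G] [TopologicalSpace G] {A : Set G}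
    (hA : HasRelativeOB A) (h1 : (1 : G) ∈ A)
    (m : MetricSpace G) (hm : IsCompatibleLeftInvariant m) :
    ∃ R : ℝ, ∀ x ∈ A, m.dist x 1 ≤ R := by
  obtain ⟨R, hR⟩ := hA m hm
  exact ⟨R, fun x hx => hR x hx 1 h1⟩

theorem IsCompatibleLeftInvariant.dist_inv_one {G : Type*} [Group G] [TopologicalSpace G]
    {m : MetricSpace G} (hm : IsCompatibleLeftInvariant m) (x : G) :
    m.dist x⁻¹ 1 = m.dist x 1 := by
  have := hm.left_invariant x x⁻¹ 1
  rw [mul_inv_cancel, mul_one] at this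
  rw [← this, m.dist_comm]

theorem IsCompatibleLeftInvariant.dist_mul_one_le {G : Type*} [Group G] [TopologicalSpace G]
    {m : MetricSpace G} (hm : IsCompatibleLeftInvariant m) (x y : G) :
    m.dist (x * y) 1 ≤ m.dist x 1 + m.dist y 1 := by
  have h1 := m.dist_triangle (x * y) x 1
  have h2 := hm.left_invariant x y 1
  rw [mul_one] at h2
  linarith

theorem exists_symm_nhds_cube_subset {S : Set G} (hS : S ∈ 𝓝 (1 : G)) :
    ∃ W ∈ 𝓝 (1 : G), (∀ a ∈ W, a⁻¹ ∈ W) ∧ ∀ a ∈ W, ∀ b ∈ W, ∀ c ∈ W, a * b * c ∈ S := by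
  have hc : Tendsto (fun z : G × G × G => z.1 * z.2.1 * z.2.2) (𝓝 (1, 1, 1)) (𝓝 1) := by
    have : Continuous (fun z : G × G × G => z.1 * z.2.1 * z.2.2) := by fun_prop
    simpa using this.tendsto (1, 1, 1)
  have h := hc hS
  rw [mem_map, nhds_prod_eq, nhds_prod_eq] at h
  obtain ⟨A, hA, T, hT, hAT⟩ := mem_prod_iff.1 h
  obtain ⟨B, hB, C, hC, hBC⟩ := mem_prod_iff.1 hT
  have hW : A ∩ B ∩ C ∈ 𝓝 (1 : G) := inter_mem (inter_mem hA hB) hC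
  refine ⟨(A ∩ B ∩ C) ∩ (A ∩ B ∩ C)⁻¹, inter_mem hW (inv_mem_nhds_one G hW), ?_, ?_⟩
  · rintro a ⟨ha, ha'⟩
    exact ⟨ha', by simpa using ha⟩
  · intro a ha b hb c hc
    exact hAT (show (a, b, c) ∈ A ×ˢ T from ⟨ha.1.1.1, hBC ⟨hb.1.1.2, hc.1.2⟩⟩)

/-- A separable metrisable group with the local property (OB) carries a metrically proper
compatible left-invariant metric. -/
theorem exists_isMetricallyProperMetric [TopologicalSpace.MetrizableSpace G]
    [TopologicalSpace.SeparableSpace G] (hOB : HasLocalOB G) :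
    ∃ m : MetricSpace G, IsMetricallyProperMetric m := by
  obtain ⟨U, hU, hUOB⟩ := hOB
  obtain ⟨W₀, hW₀, hW₀inv, hW₀U⟩ := exists_symm_nhds_cube_subset hU
  have h1W₀ := mem_of_mem_nhds hW₀
  have hW₀b : ∀ m : MetricSpace G, IsCompatibleLeftInvariant m →
      ∃ R : ℝ, ∀ x ∈ W₀, m.dist x 1 ≤ R := by
    intro m hm
    obtain ⟨R, hR⟩ := hUOB.dist_one_le (mem_of_mem_nhds hU) m hm
    exact ⟨R, fun x hx => hR x (by simpa using hW₀U x hx 1 h1W₀ 1 h1W₀)⟩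
  obtain ⟨O, hO⟩ := (𝓝 (1 : G)).exists_antitone_basis
  let x := TopologicalSpace.denseSeq G
  -- The increasing half of the chain. Cubes and one more point of a dense sequence at each step
  -- keep every `A n` bounded for every compatible left-invariant metric, while the `A n` exhaust
  -- `G`.
  obtain ⟨A, hA0, hAs⟩ : ∃ A : ℕ → Set G, A 0 = W₀ ∧ ∀ n, A (n + 1) =
      {g | ∃ a ∈ A n, ∃ b ∈ A n, ∃ c ∈ A n, a * b * c = g} ∪ {x n, (x n)⁻¹} :=
    ⟨fun n => Nat.rec W₀
      (fun k S => {g | ∃ a ∈ S, ∃ b ∈ S, ∃ c ∈ S, a * b * c = g} ∪ {x k, (x k)⁻¹}) n,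
      rfl, fun _ => rfl⟩
  have hAcube : ∀ n, ∀ a ∈ A n, ∀ b ∈ A n, ∀ c ∈ A n, a * b * c ∈ A (n + 1) := by
    intro n a ha b hb c hc
    rw [hAs]
    exact Or.inl ⟨a, ha, b, hb, c, hc, rfl⟩
  have hA1 : ∀ n, (1 : G) ∈ A n := by
    intro n
    induction n with
    | zero => rwa [hA0]
    | succ n ih => simpa using hAcube n 1 ih 1 ih 1 ih
  have hAsucc : ∀ n, A n ⊆ A (n + 1) := fun n a ha => by
    simpa using hAcube n a ha 1 (hA1 n) 1 (hA1 n)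
  have hAmono : Monotone A := monotone_nat_of_le_succ hAsucc
  have hAinv : ∀ n, ∀ a ∈ A n, a⁻¹ ∈ A n := by
    intro n
    induction n with
    | zero => rwa [hA0]
    | succ n ih =>
      rw [hAs]
      rintro _ (⟨a, ha, b, hb, c, hc, rfl⟩ | rfl | rfl)
      · exact Or.inl ⟨c⁻¹, ih c hc, b⁻¹, ih b hb, a⁻¹, ih a ha, by simp [mul_assoc]⟩
      · exact Or.inr (Or.inr rfl)
      · exact Or.inr (Or.inl (inv_inv _))
  have hAb : ∀ m : MetricSpace G, IsCompatibleLeftInvariant m → ∀ n,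
      ∃ R : ℝ, ∀ g ∈ A n, m.dist g 1 ≤ R := by
    intro m hm n
    induction n with
    | zero => simpa only [hA0] using hW₀b m hm
    | succ n ih =>
      rw [hAs]
      obtain ⟨R, hR⟩ := ih
      refine ⟨max (R + R + R) (m.dist (x n) 1), ?_⟩
      rintro _ (⟨a, ha, b, hb, c, hc, rfl⟩ | rfl | rfl)
      · refine le_max_of_le_left ?_
        have h1 := hm.dist_mul_one_le (a * b) c
        have h2 := hm.dist_mul_one_le a b
        linarith [hR a ha, hR b hb, hR c hc]
      · exact le_max_right _ _
      · rw [hm.dist_inv_one]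
        exact le_max_right _ _
  choose! step hstep_nhds hstep_inv hstep_cube using
    fun S : Set G => exists_symm_nhds_cube_subset (S := S)
  -- The decreasing half: intersecting with `O n` makes the `B n` a neighbourhood basis.
  obtain ⟨B, hB0, hBs⟩ : ∃ B : ℕ → Set G, B 0 = W₀ ∧ ∀ n, B (n + 1) = step (B n ∩ O n) :=
    ⟨fun n => Nat.rec W₀ (fun k S => step (S ∩ O k)) n, rfl, fun _ => rfl⟩
  have hBn : ∀ n, B n ∈ 𝓝 (1 : G) := by
    intro n
    induction n with
    | zero => rwa [hB0]
    | succ n ih =>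
      rw [hBs]
      exact hstep_nhds _ (inter_mem ih (hO.mem n))
  have hBO : ∀ n, B n ∩ O n ∈ 𝓝 (1 : G) := fun n => inter_mem (hBn n) (hO.mem n)
  have hBcube : ∀ n, ∀ a ∈ B (n + 1), ∀ b ∈ B (n + 1), ∀ c ∈ B (n + 1),
      a * b * c ∈ B n ∩ O n := fun n => by
    rw [hBs]
    exact hstep_cube _ (hBO n)
  have hBsub : ∀ n, B (n + 1) ⊆ B n ∩ O n := fun n a ha => by
    have h1 := mem_of_mem_nhds (hBn (n + 1))
    simpa using hBcube n a ha 1 h1 1 h1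
  -- `Int.negSucc k` is `-(k + 1)`, so `B (k + 1)` sits at level `-(k + 1)` and the two halves meet
  -- at level `0` in `B 0 = A 0 = W₀`.
  obtain ⟨V, hVA, hVB⟩ : ∃ V : ℤ → Set G, (∀ k : ℕ, V k = A k) ∧
      ∀ k : ℕ, V (Int.negSucc k) = B (k + 1) :=
    ⟨fun n => Int.rec A (fun k => B (k + 1)) n, fun _ => rfl, fun _ => rfl⟩
  have hV0 : V (Int.negSucc 0 + 1) = B 0 := by
    rw [hB0, ← hA0, ← hVA]
    rfl
  have hVsucc : ∀ k : ℕ, V (Int.negSucc k + 1) = B k := by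
    rintro (_ | k)
    · exact hV0
    · exact hVB k
  have hVsucc' : ∀ k : ℕ, V ((k : ℤ) + 1) = A (k + 1) := fun k => hVA (k + 1)
  have hVmono : Monotone V := by
    refine monotone_int_of_le_succ fun n => ?_
    rcases n with k | k
    · rw [Int.ofNat_eq_natCast, hVsucc', hVA]
      exact hAsucc k
    · rw [hVB, hVsucc]
      exact (hBsub k).trans Set.inter_subset_left
  have hVcov : ∀ g, ∃ n, g ∈ V n := by
    intro g
    have h1 : {y | y⁻¹ * g ∈ W₀} ∈ 𝓝 g := by
      have : Continuous fun y : G => y⁻¹ * g := by fun_prop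
      exact this.continuousAt.preimage_mem_nhds (by simpa using hW₀)
    obtain ⟨_, ⟨k, rfl⟩, hy⟩ := (TopologicalSpace.denseRange_denseSeq G).inter_nhds_nonempty h1
    have hxk : x k ∈ A (k + 1) := by
      rw [hAs]
      exact Or.inr (Or.inl rfl)
    have hy' : (x k)⁻¹ * g ∈ A 0 := by
      rw [hA0]
      exact hy
    -- `g = x k * ((x k)⁻¹ * g) * 1` with `x k ∈ A (k + 1)` and the second factor in `W₀`.
    refine ⟨(k + 1 + 1 : ℕ), ?_⟩
    rw [hVA]
    simpa using hAcube (k + 1) (x k) hxk _ (hAmono (Nat.zero_le _) hy') 1 (hA1 _)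
  obtain ⟨m, hm, hmV⟩ := exists_compatible_leftInvariant_metric (V := V) hVmono hVcov
    (by
      rintro (k | k)
      · rw [Int.ofNat_eq_natCast, hVA]
        exact hAinv k
      · rw [hVB, hBs]
        exact hstep_inv _ (hBO k))
    (by
      rintro (k | k)
      · rw [Int.ofNat_eq_natCast, hVsucc', hVA]
        exact hAcube k
      · rw [hVB, hVsucc]
        exact fun a ha b hb c hc => (hBcube k a ha b hb c hc).1)
    (by
      rintro (k | k)
      · rw [Int.ofNat_eq_natCast, hVA]
        exact mem_of_superset hW₀ (hA0 ▸ hAmono (Nat.zero_le k))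
      · rw [hVB]
        exact hBn (k + 1))
    (by
      intro S hS
      obtain ⟨n, -, hn⟩ := hO.toHasBasis.mem_iff.1 hS
      refine ⟨Int.negSucc n, ?_⟩
      rw [hVB]
      exact ((hBsub n).trans Set.inter_subset_right).trans hn)
  refine ⟨m, hm, fun g hg => ?_⟩
  obtain ⟨m', hm', hg'⟩ := hg
  rw [tendsto_atTop] at hg' ⊢
  intro R
  -- If `m.dist (g n) 1 < R < 2 ^ k`, then `g n ∈ A k`, which is bounded for `m'`; this fails once
  -- `m'.dist (g n) 1` is large.
  obtain ⟨k, hk⟩ := pow_unbounded_of_one_lt R (by norm_num : (1 : ℝ) < 2)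
  obtain ⟨S, hS⟩ := hAb m' hm' k
  filter_upwards [hg' (S + 1)] with n hn
  by_contra! hlt
  have := hmV k (g n) (by
    have h2 := hlt.trans hk
    simpa using h2)
  rw [hVA] at this
  linarith [hS (g n) this]

end ProperMetric

/-! ### Hypercontractivity of Rademacher sums and Kahane's inequality. -/

section Kahane

theorem card_signs (n : ℕ) : (Fintype.card (Fin n → ℤˣ) : ℝ) = 2 ^ n := by
  simp

/-- Power means over the uniform distribution on signs are monotone in the exponent. -/
theorem signMean_rpow_mono {n : ℕ} {f : (Fin n → ℤˣ) → ℝ} (hf : ∀ ε, 0 ≤ f ε) {p r : ℝ}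
    (hp : 0 < p) (hpr : p ≤ r) :
    ((2 ^ n)⁻¹ * ∑ ε, f ε ^ p) ^ (1 / p) ≤ ((2 ^ n)⁻¹ * ∑ ε, f ε ^ r) ^ (1 / r) := by
  have hr : 0 < r := hp.trans_le hpr
  have h := Real.arith_mean_le_rpow_mean Finset.univ (fun _ : Fin n → ℤˣ => ((2 : ℝ) ^ n)⁻¹)
    (fun ε => f ε ^ p) (fun _ _ => by positivity)
    (by rw [Finset.sum_const, Finset.card_univ, nsmul_eq_mul, card_signs]; field_simp)
    (fun ε _ => Real.rpow_nonneg (hf ε) p) (p := r / p) ((one_le_div hp).2 hpr)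
  have e : ∀ ε, (f ε ^ p) ^ (r / p) = f ε ^ r := fun ε => by
    rw [← Real.rpow_mul (hf ε)]
    congr 1
    field_simp
  simp only [e, ← Finset.mul_sum] at h
  have h0 : 0 ≤ (2 ^ n)⁻¹ * ∑ ε, f ε ^ p :=
    mul_nonneg (by positivity) (Finset.sum_nonneg fun ε _ => Real.rpow_nonneg (hf ε) p)
  have h0' : 0 ≤ (2 ^ n)⁻¹ * ∑ ε, f ε ^ r :=
    mul_nonneg (by positivity) (Finset.sum_nonneg fun ε _ => Real.rpow_nonneg (hf ε) r)
  refine (Real.rpow_le_rpow h0 h (by positivity)).trans_eq ?_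
  rw [← Real.rpow_mul h0']
  congr 1
  field_simp

/-- Since `(A ± B)² = (A² + B²) ± 2AB`, the case `j` applied to `A² + B²` and `2AB` yields `j + 1`.
The constant `1 + 2c` makes the `A²B²` terms agree. -/
theorem two_point_inequality (j : ℕ) : ∃ c : ℝ, 1 ≤ c ∧ ∀ A B : ℝ,
    ((A + B) ^ (2 * 2 ^ j) + (A - B) ^ (2 * 2 ^ j)) / 2 ≤ (A ^ 2 + c * B ^ 2) ^ 2 ^ j := by
  induction j with
  | zero => exact ⟨1, le_rfl, fun A B => by norm_num; nlinarith⟩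
  | succ j ih =>
    obtain ⟨c, hc, h⟩ := ih
    refine ⟨1 + 2 * c, by linarith, fun A B => ?_⟩
    have h1 := h (A ^ 2 + B ^ 2) (2 * A * B)
    have e1 : A ^ 2 + B ^ 2 + 2 * A * B = (A + B) ^ 2 := by ring
    have e2 : A ^ 2 + B ^ 2 - 2 * A * B = (A - B) ^ 2 := by ring
    rw [e1, e2, ← pow_mul, ← pow_mul] at h1
    have e3 : 2 * 2 ^ (j + 1) = 2 * (2 * 2 ^ j) := by ring
    rw [e3, pow_succ' 2 j, pow_mul _ 2 (2 ^ j)]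
    refine h1.trans (pow_le_pow_left₀ (by positivity) ?_ _)
    nlinarith [sq_nonneg (A * B), sq_nonneg (B ^ 2),
      mul_nonneg (by linarith : 0 ≤ c) (sq_nonneg (B ^ 2)),
      mul_nonneg (by nlinarith : 0 ≤ c ^ 2) (sq_nonneg (B ^ 2))]

variable {X : Type*} [NormedAddCommGroup X] [NormedSpace ℝ X]

/-- The vectors `y ± c⁻¹ z` are convex combinations of `y + z` and `y - z`, which reduces the claim
to the scalar inequality for `A = (a + b) / 2` and `B = c⁻¹ (a - b) / 2`. There `c * B²` is at most
`((a - b) / 2)²`. -/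
theorem norm_two_point_inequality {k : ℕ} {c : ℝ} (hc : 1 ≤ c)
    (h : ∀ A B : ℝ, ((A + B) ^ (2 * k) + (A - B) ^ (2 * k)) / 2 ≤ (A ^ 2 + c * B ^ 2) ^ k)
    (y z : X) :
    (‖y + c⁻¹ • z‖ ^ (2 * k) + ‖y - c⁻¹ • z‖ ^ (2 * k)) / 2 ≤
      (‖y + z‖ ^ 2 / 2 + ‖y - z‖ ^ 2 / 2) ^ k := by
  set s := c⁻¹
  have hs0 : 0 ≤ s := by positivity
  have hs1 : s ≤ 1 := inv_le_one_of_one_le₀ hc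
  set a := ‖y + z‖
  set b := ‖y - z‖
  have key : ∀ w : X, ∀ a' b' : ℝ, ‖y + w‖ = a' → ‖y - w‖ = b' →
      ‖y + s • w‖ ≤ (1 + s) / 2 * a' + (1 - s) / 2 * b' := by
    rintro w _ _ rfl rfl
    have e : y + s • w = ((1 + s) / 2) • (y + w) + ((1 - s) / 2) • (y - w) := by module
    rw [e]
    refine (norm_add_le _ _).trans_eq ?_
    rw [norm_smul, norm_smul, Real.norm_of_nonneg (by linarith), Real.norm_of_nonneg (by linarith)]
  have h1 := key z a b rfl rfl
  have h2 := key (-z) b a (by rw [← sub_eq_add_neg]) (by rw [sub_neg_eq_add])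
  rw [smul_neg, ← sub_eq_add_neg] at h2
  have h3 := h ((a + b) / 2) (s * ((a - b) / 2))
  have e1 : (a + b) / 2 + s * ((a - b) / 2) = (1 + s) / 2 * a + (1 - s) / 2 * b := by ring
  have e2 : (a + b) / 2 - s * ((a - b) / 2) = (1 + s) / 2 * b + (1 - s) / 2 * a := by ring
  rw [e1, e2] at h3
  have h4 := pow_le_pow_left₀ (norm_nonneg _) h1 (2 * k)
  have h5 := pow_le_pow_left₀ (norm_nonneg _) h2 (2 * k)
  have h6 : c * s = 1 := mul_inv_cancel₀ (by positivity)
  have h7 : ((a + b) / 2) ^ 2 + c * (s * ((a - b) / 2)) ^ 2 ≤ a ^ 2 / 2 + b ^ 2 / 2 := by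
    have : c * (s * ((a - b) / 2)) ^ 2 = s * ((a - b) / 2) ^ 2 := by
      calc c * (s * ((a - b) / 2)) ^ 2 = (c * s) * s * ((a - b) / 2) ^ 2 := by ring
        _ = _ := by rw [h6, one_mul]
    rw [this]
    nlinarith [sq_nonneg ((a - b) / 2)]
  have h8 := pow_le_pow_left₀ (by positivity) h7 k
  linarith

/-- The mean of `f (x₀ + ∑ εᵢ xᵢ)` over all signs. -/
noncomputable def signMean (f : X → ℝ) (x₀ : X) {n : ℕ} (x : Fin n → X) : ℝ :=
  (2 ^ n)⁻¹ * ∑ ε : Fin n → ℤˣ, f (x₀ + ∑ i, ((ε i : ℤ) : ℝ) • x i)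

theorem signMean_succ (f : X → ℝ) (x₀ : X) {n : ℕ} (x : Fin (n + 1) → X) :
    signMean f x₀ x = signMean (fun y => (f (y + x 0) + f (y - x 0)) / 2) x₀ (Fin.tail x) := by
  unfold signMean
  rw [← (Fin.consEquiv fun _ : Fin (n + 1) => ℤˣ).sum_comp, Fintype.sum_prod_type,
    UnitsInt.univ, Finset.sum_pair (by decide), ← Finset.sum_add_distrib, pow_succ, mul_inv,
    mul_assoc, Finset.mul_sum _ _ (2 : ℝ)⁻¹]
  congr 1
  refine Finset.sum_congr rfl fun ε _ => ?_
  simp only [Fin.consEquiv_apply, Fin.sum_univ_succ, Fin.cons_zero, Fin.cons_succ, Fin.tail]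
  rw [div_eq_inv_mul]
  congr 3
  · simp; abel
  · simp; abel

theorem signMean_mono {f g : X → ℝ} (h : ∀ y, f y ≤ g y) (x₀ : X) {n : ℕ} (x : Fin n → X) :
    signMean f x₀ x ≤ signMean g x₀ x :=
  mul_le_mul_of_nonneg_left (Finset.sum_le_sum fun _ _ => h _) (by positivity)

theorem signMean_nonneg {f : X → ℝ} (h : ∀ y, 0 ≤ f y) (x₀ : X) {n : ℕ} (x : Fin n → X) :
    0 ≤ signMean f x₀ x :=
  mul_nonneg (by positivity) (Finset.sum_nonneg fun _ _ => h _)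

/-- Minkowski's inequality in `Lᵏ` of the uniform measure on signs, stated without roots. -/
theorem signMean_add_pow_le {f g : X → ℝ} (hf : ∀ y, 0 ≤ f y) (hg : ∀ y, 0 ≤ g y) {k : ℕ}
    (hk : 1 ≤ k) {a b : ℝ} (ha : 0 ≤ a) (hb : 0 ≤ b) {x₀ : X} {n : ℕ} {x : Fin n → X}
    (hfa : signMean (fun y => f y ^ k) x₀ x ≤ a ^ k)
    (hgb : signMean (fun y => g y ^ k) x₀ x ≤ b ^ k) :
    signMean (fun y => (f y + g y) ^ k) x₀ x ≤ (a + b) ^ k := by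
  unfold signMean at *
  have h2 : (0 : ℝ) < 2 ^ n := by positivity
  have hk0 : k ≠ 0 := by omega
  have hk' : (0 : ℝ) < k := by positivity
  rw [inv_mul_le_iff₀ h2] at hfa hgb ⊢
  have h := Real.Lp_add_le_of_nonneg (Finset.univ : Finset (Fin n → ℤˣ)) (p := k)
    (f := fun ε => f (x₀ + ∑ i, ((ε i : ℤ) : ℝ) • x i))
    (g := fun ε => g (x₀ + ∑ i, ((ε i : ℤ) : ℝ) • x i)) (by exact_mod_cast hk)
    (fun _ _ => hf _) (fun _ _ => hg _)
  simp only [Real.rpow_natCast] at h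
  have key : ∀ {S t : ℝ}, 0 ≤ S → 0 ≤ t → S ≤ 2 ^ n * t ^ k →
      S ^ (1 / (k : ℝ)) ≤ (2 ^ n) ^ (1 / (k : ℝ)) * t := by
    intro S t hS ht hSt
    refine (Real.rpow_le_rpow hS hSt (by positivity)).trans_eq ?_
    rw [Real.mul_rpow h2.le (by positivity), one_div, Real.pow_rpow_inv_natCast ht hk0]
  have h3 := h.trans (add_le_add
    (key (Finset.sum_nonneg fun _ _ => pow_nonneg (hf _) k) ha hfa)
    (key (Finset.sum_nonneg fun _ _ => pow_nonneg (hg _) k) hb hgb))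
  rw [← mul_add] at h3
  have hS : 0 ≤ ∑ ε : Fin n → ℤˣ, (f (x₀ + ∑ i, ((ε i : ℤ) : ℝ) • x i) +
      g (x₀ + ∑ i, ((ε i : ℤ) : ℝ) • x i)) ^ k :=
    Finset.sum_nonneg fun _ _ => pow_nonneg (add_nonneg (hf _) (hg _)) k
  have h4 := pow_le_pow_left₀ (by positivity) h3 k
  rwa [mul_pow, one_div, Real.rpow_inv_natCast_pow hS hk0, Real.rpow_inv_natCast_pow h2.le hk0]
    at h4

/-- Hypercontractivity of Rademacher sums: even moments of the damped sum are controlled by the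
second moment. -/
theorem signMean_pow_le {k : ℕ} (hk : 1 ≤ k) {c : ℝ} (hc : 1 ≤ c)
    (h : ∀ A B : ℝ, ((A + B) ^ (2 * k) + (A - B) ^ (2 * k)) / 2 ≤ (A ^ 2 + c * B ^ 2) ^ k)
    {n : ℕ} (x : Fin n → X) (x₀ : X) :
    signMean (fun y => ‖y‖ ^ (2 * k)) x₀ (fun i => c⁻¹ • x i) ≤
      signMean (fun y => ‖y‖ ^ 2) x₀ x ^ k := by
  induction n generalizing x₀ with
  | zero => simp [signMean, pow_mul]
  | succ n ih =>
    have hshift : ∀ (f : X → ℝ) (w : X) (z : Fin n → X),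
        signMean (fun y => f (y + w)) x₀ z = signMean f (x₀ + w) z := fun f w z => by
      simp only [signMean, add_right_comm]
    have hconst : ∀ (f : X → ℝ) (t : ℝ) (z₀ : X) (z : Fin n → X),
        signMean (fun y => f y / t) z₀ z = signMean f z₀ z / t := fun f t z₀ z => by
      simp only [signMean, ← Finset.sum_div, mul_div_assoc]
    have hterm : ∀ w : X, signMean (fun y => (‖y + w‖ ^ 2 / 2) ^ k) x₀
        (fun i => c⁻¹ • Fin.tail x i) ≤
        (signMean (fun y => ‖y‖ ^ 2) (x₀ + w) (Fin.tail x) / 2) ^ k := fun w => by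
      have e : (fun y : X => (‖y + w‖ ^ 2 / 2) ^ k) =
          fun y => (fun y' : X => ‖y'‖ ^ (2 * k)) (y + w) / 2 ^ k := by
        funext y
        rw [div_pow, ← pow_mul]
      rw [e, hconst, hshift (fun y' : X => ‖y'‖ ^ (2 * k)), div_pow]
      exact div_le_div_of_nonneg_right (ih _ _) (by positivity)
    rw [signMean_succ, signMean_succ]
    -- The two-point inequality handles the first sign, Minkowski in `Lᵏ` over the other signs
    -- separates the two squares, and the induction hypothesis applies at the base points `x₀ ± x
    -- 0`.
    refine (signMean_mono (fun y => norm_two_point_inequality hc h y (x 0)) _ _).trans ?_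
    have e : signMean (fun y => (‖y + x 0‖ ^ 2 + ‖y - x 0‖ ^ 2) / 2) x₀ (Fin.tail x) =
        signMean (fun y => ‖y‖ ^ 2) (x₀ + x 0) (Fin.tail x) / 2 +
        signMean (fun y => ‖y‖ ^ 2) (x₀ + -x 0) (Fin.tail x) / 2 := by
      rw [hconst, ← add_div, ← hshift (fun y => ‖y‖ ^ 2), ← hshift (fun y => ‖y‖ ^ 2)]
      simp only [signMean, ← mul_add, ← Finset.sum_add_distrib, sub_eq_add_neg]
    rw [e]
    have hn : ∀ w, 0 ≤ signMean (fun y : X => ‖y‖ ^ 2) w (Fin.tail x) / 2 := fun w =>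
      div_nonneg (signMean_nonneg (fun _ => by positivity) _ _) two_pos.le
    have hneg := hterm (-x 0)
    simp only [← sub_eq_add_neg] at hneg ⊢
    exact signMean_add_pow_le (fun _ => by positivity) (fun _ => by positivity) hk (hn _) (hn _)
      (hterm _) hneg

theorem rademacherMoment_eq_signMean (k : ℕ) {n : ℕ} (x : Fin n → X) :
    rademacherMoment k x = signMean (fun y => ‖y‖ ^ k) 0 x := by
  simp [rademacherMoment, signMean]

theorem rademacherMoment_nonneg (r : ℝ) {n : ℕ} (x : Fin n → X) : 0 ≤ rademacherMoment r x :=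
  mul_nonneg (by positivity) (Finset.sum_nonneg fun _ _ => Real.rpow_nonneg (norm_nonneg _) _)

/-- Homogeneity removes the damping `c⁻¹` at the price `c ^ (2 * 2 ^ j)`, which depends neither on
the space nor on the number of vectors. -/
theorem exists_rademacherMoment_le_two (j : ℕ) : ∃ C : ℝ, 1 ≤ C ∧
    ∀ (X : Type v) [NormedAddCommGroup X] [NormedSpace ℝ X] (n : ℕ) (x : Fin n → X),
      rademacherMoment (2 * 2 ^ j : ℕ) x ≤
        C * rademacherMoment (2 : ℕ) x ^ 2 ^ j := by
  obtain ⟨c, hc, h⟩ := two_point_inequality j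
  refine ⟨c ^ (2 * 2 ^ j), one_le_pow₀ hc, fun X _ _ n x => ?_⟩
  have h1 := signMean_pow_le Nat.one_le_two_pow hc h x 0
  have e : signMean (fun y => ‖y‖ ^ (2 * 2 ^ j)) 0 (fun i => c⁻¹ • x i) =
      (c ^ (2 * 2 ^ j))⁻¹ * signMean (fun y => ‖y‖ ^ (2 * 2 ^ j)) 0 x := by
    simp only [signMean, zero_add]
    rw [mul_left_comm]
    congr 1
    rw [Finset.mul_sum]
    refine Finset.sum_congr rfl fun ε _ => ?_
    have hs : ∑ i, ((ε i : ℤ) : ℝ) • c⁻¹ • x i = c⁻¹ • ∑ i, ((ε i : ℤ) : ℝ) • x i := by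
      rw [Finset.smul_sum]
      exact Finset.sum_congr rfl fun i _ => smul_comm _ _ _
    rw [hs, norm_smul, mul_pow, norm_inv, Real.norm_of_nonneg (by linarith), inv_pow]
  rw [e, inv_mul_le_iff₀ (by positivity)] at h1
  rw [rademacherMoment_eq_signMean, rademacherMoment_eq_signMean]
  exact h1

/-- The second moment is interpolated between the first and the fourth by `t² ≤ a t + t⁴ / a²`. For
`a² = 2 C m₂` the bound `m₄ ≤ C m₂²` makes the last term at most `m₂ / 2`, so it is absorbed on the
left. -/
theorem exists_rademacherMoment_two_le_one : ∃ C : ℝ, 0 ≤ C ∧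
    ∀ (X : Type v) [NormedAddCommGroup X] [NormedSpace ℝ X] (n : ℕ) (x : Fin n → X),
      rademacherMoment (2 : ℕ) x ^ (1 / 2 : ℝ) ≤ C * rademacherMoment (1 : ℕ) x := by
  obtain ⟨C, hC1, hC⟩ := exists_rademacherMoment_le_two.{v} 1
  refine ⟨2 * √(2 * C), by positivity, fun X _ _ n x => ?_⟩
  have h4 : signMean (fun y : X => ‖y‖ ^ 4) 0 x ≤ C * signMean (fun y => ‖y‖ ^ 2) 0 x ^ 2 := by
    have := hC X n x
    rw [rademacherMoment_eq_signMean, rademacherMoment_eq_signMean] at this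
    exact this
  rw [rademacherMoment_eq_signMean, rademacherMoment_eq_signMean]
  set m₂ := signMean (fun y : X => ‖y‖ ^ 2) 0 x
  set m₁ := signMean (fun y : X => ‖y‖ ^ 1) 0 x
  have hm₁ : 0 ≤ m₁ := signMean_nonneg (fun _ => by positivity) _ _
  have hm₂ : 0 ≤ m₂ := signMean_nonneg (fun _ => by positivity) _ _
  rw [← Real.sqrt_eq_rpow]
  rcases hm₂.eq_or_lt with h0 | hpos
  · rw [← h0]
    simp only [Real.sqrt_zero]
    positivity
  set a := √(2 * C * m₂)
  have ha : 0 < a := Real.sqrt_pos.2 (by positivity)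
  have ha2 : a ^ 2 = 2 * C * m₂ := Real.sq_sqrt (by positivity)
  have hpt : ∀ y : X, ‖y‖ ^ 2 ≤ a * ‖y‖ ^ 1 + ‖y‖ ^ 4 / a ^ 2 := by
    intro y
    have hy := norm_nonneg y
    rcases le_total ‖y‖ a with hya | hya
    · have : 0 ≤ ‖y‖ ^ 4 / a ^ 2 := by positivity
      nlinarith
    · have : ‖y‖ ^ 2 ≤ ‖y‖ ^ 4 / a ^ 2 := by
        rw [le_div_iff₀ (by positivity)]
        nlinarith [mul_le_mul hya hya ha.le hy, sq_nonneg ‖y‖]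
      have : 0 ≤ a * ‖y‖ ^ 1 := by positivity
      linarith
  have h5 := signMean_mono hpt 0 x
  have e : signMean (fun y : X => a * ‖y‖ ^ 1 + ‖y‖ ^ 4 / a ^ 2) 0 x =
      a * m₁ + signMean (fun y : X => ‖y‖ ^ 4) 0 x / a ^ 2 := by
    simp only [m₁, signMean, Finset.sum_add_distrib, ← Finset.mul_sum, ← Finset.sum_div]
    ring
  rw [e] at h5
  have h6 : signMean (fun y : X => ‖y‖ ^ 4) 0 x / a ^ 2 ≤ m₂ / 2 := by
    rw [div_le_iff₀ (by positivity), ha2]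
    linarith
  have h7 : m₂ ≤ 2 * a * m₁ := by
    have : m₂ ≤ a * m₁ + m₂ / 2 := h5.trans (by linarith)
    linarith
  have h8 : a = √(2 * C) * √m₂ := Real.sqrt_mul (by positivity) _
  have h9 : √m₂ * √m₂ = m₂ := Real.mul_self_sqrt hm₂
  have h10 : 0 < √m₂ := Real.sqrt_pos.2 hpos
  rw [h8] at h7
  refine le_of_mul_le_mul_right ?_ h10
  linarith

/-- Kahane's inequality. -/
theorem kahane_inequality {p r : ℝ} (hp : 1 ≤ p) (hr : 0 < r) : ∃ C : ℝ, 0 ≤ C ∧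
    ∀ (X : Type v) [NormedAddCommGroup X] [NormedSpace ℝ X] (n : ℕ) (x : Fin n → X),
      rademacherMoment r x ^ (1 / r) ≤ C * rademacherMoment p x ^ (1 / p) := by
  obtain ⟨j, hj⟩ := pow_unbounded_of_one_lt r (by norm_num : (1 : ℝ) < 2)
  obtain ⟨C, hC1, hC⟩ := exists_rademacherMoment_le_two.{v} j
  obtain ⟨D, hD0, hD⟩ := exists_rademacherMoment_two_le_one.{v}
  -- An even exponent above `r`. The exponents are compared along `r ≤ m`, `m → 2`, `2 → 1`, `1 ≤
  -- p`: the outer steps are monotonicity of power means, the inner ones hypercontractivity.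
  set m : ℕ := 2 * 2 ^ j
  have hm : 0 < (m : ℝ) := by positivity
  have hrm : r ≤ m := by
    simp only [m]
    push_cast
    nlinarith
  refine ⟨C ^ (1 / (m : ℝ)) * D, by positivity, fun X _ _ n x => ?_⟩
  have h1 : rademacherMoment r x ^ (1 / r) ≤ rademacherMoment m x ^ (1 / (m : ℝ)) :=
    signMean_rpow_mono (fun ε => norm_nonneg _) hr hrm
  have h2 : rademacherMoment (1 : ℕ) x ≤ rademacherMoment p x ^ (1 / p) := by
    have := signMean_rpow_mono (f := fun ε => ‖∑ i, ((ε i : ℤ) : ℝ) • x i‖)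
      (fun ε => norm_nonneg _) one_pos hp
    simpa [rademacherMoment] using this
  have h3 := Real.rpow_le_rpow (rademacherMoment_nonneg _ x) (hC X n x)
    (by positivity : 0 ≤ 1 / (m : ℝ))
  have hm2 := rademacherMoment_nonneg ((2 : ℕ) : ℝ) x
  have e : (rademacherMoment (2 : ℕ) x ^ 2 ^ j) ^ (1 / (m : ℝ)) =
      rademacherMoment (2 : ℕ) x ^ (1 / 2 : ℝ) := by
    rw [← Real.rpow_natCast, ← Real.rpow_mul hm2]
    congr 1
    simp only [m]
    push_cast
    field_simp
  rw [Real.mul_rpow (by positivity) (by positivity), e] at h3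
  refine h1.trans (h3.trans ?_)
  rw [mul_assoc]
  refine mul_le_mul_of_nonneg_left ?_ (by positivity)
  exact (hD X n x).trans (mul_le_mul_of_nonneg_left h2 hD0)

end Kahane

/-! ### Type and cotype of `Lᵖ(μ, E)`. -/

section LpSpaces

open MeasureTheory

variable {Ω : Type u} [MeasurableSpace Ω] {μ : Measure Ω}

theorem lpNorm_ofReal_rpow {E : Type*} [NormedAddCommGroup E] {f : Ω → E} {p : ℝ} (hp : 1 ≤ p)
    (hf : MemLp f (ENNReal.ofReal p) μ) :
    lpNorm f (ENNReal.ofReal p) μ ^ p = ∫ x, ‖f x‖ ^ p ∂μ := by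
  have hp0 : 0 < p := by linarith
  rw [lpNorm_eq_integral_norm_rpow_toReal (by simpa using hp0) ENNReal.ofReal_ne_top
    hf.aestronglyMeasurable, ENNReal.toReal_ofReal hp0.le, Real.rpow_inv_rpow _ hp0.ne']
  exact integral_nonneg fun _ => by positivity

theorem integrable_norm_rpow_ofReal {E : Type*} [NormedAddCommGroup E] {f : Ω → E} {p : ℝ}
    (hp : 1 ≤ p) (hf : MemLp f (ENNReal.ofReal p) μ) : Integrable (fun x => ‖f x‖ ^ p) μ := by
  have hp0 : 0 < p := by linarith
  have := hf.integrable_norm_rpow (by simpa using hp0) ENNReal.ofReal_ne_top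
  rwa [ENNReal.toReal_ofReal hp0.le] at this

/-- Minkowski's integral inequality for finite families. -/
theorem sum_integral_rpow_le {n : ℕ} {g : Fin n → Ω → ℝ} (hg : ∀ i, Integrable (g i) μ)
    (hg0 : ∀ i x, 0 ≤ g i x) {s : ℝ} (hs : 1 ≤ s) :
    (∑ i, (∫ x, g i x ∂μ) ^ s) ^ (1 / s) ≤ ∫ x, (∑ i, g i x ^ s) ^ (1 / s) ∂μ := by
  have hs0 : 0 < s := by linarith
  have : Fact (1 ≤ ENNReal.ofReal s) := ⟨by simpa using hs⟩
  -- The inequality is `‖∫ f‖ ≤ ∫ ‖f‖` for this `ℓˢ`-valued function.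
  let f : Ω → PiLp (ENNReal.ofReal s) (fun _ : Fin n => ℝ) := fun x => WithLp.toLp _ fun i => g i x
  have hnorm : ∀ y : PiLp (ENNReal.ofReal s) (fun _ : Fin n => ℝ), (∀ i, 0 ≤ y i) →
      ‖y‖ = (∑ i, y i ^ s) ^ (1 / s) := by
    intro y hy
    rw [PiLp.norm_eq_sum (by rwa [ENNReal.toReal_ofReal hs0.le]), ENNReal.toReal_ofReal hs0.le]
    simp only [Real.norm_of_nonneg (hy _)]
  have hint : ∀ i, (∫ x, f x ∂μ) i = ∫ x, g i x ∂μ := fun i => eval_integral_piLp hg i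
  have h := norm_integral_le_integral_norm (μ := μ) f
  rw [hnorm _ fun i => by rw [hint]; exact integral_nonneg (hg0 i)] at h
  simp only [hint, hnorm (f _) fun i => hg0 i _] at h
  exact h

variable {E : Type v} [NormedAddCommGroup E] [NormedSpace ℝ E]

theorem memLp_sign_sum {p : ℝ≥0∞} {n : ℕ} {F : Fin n → Ω → E} (hF : ∀ i, MemLp (F i) p μ)
    (ε : Fin n → ℤˣ) : MemLp (∑ i, ((ε i : ℤ) : ℝ) • F i) p μ :=
  memLp_finsetSum' _ fun i _ => (hF i).const_smul _

theorem integrable_rademacherMoment {p : ℝ} (hp : 1 ≤ p) {n : ℕ} {F : Fin n → Ω → E}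
    (hF : ∀ i, MemLp (F i) (ENNReal.ofReal p) μ) :
    Integrable (fun x => rademacherMoment p fun i => F i x) μ := by
  refine (integrable_finsetSum _ fun ε _ => ?_).const_mul _
  simpa using integrable_norm_rpow_ofReal hp (memLp_sign_sum hF ε)

theorem integral_rademacherMoment {p : ℝ} (hp : 1 ≤ p) {n : ℕ} {F : Fin n → Ω → E}
    (hF : ∀ i, MemLp (F i) (ENNReal.ofReal p) μ) :
    ∫ x, rademacherMoment p (fun i => F i x) ∂μ =
      (2 ^ n)⁻¹ * ∑ ε : Fin n → ℤˣ,
        lpNorm (∑ i, ((ε i : ℤ) : ℝ) • F i) (ENNReal.ofReal p) μ ^ p := by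
  have h : ∀ ε : Fin n → ℤˣ, Integrable (fun x => ‖∑ i, ((ε i : ℤ) : ℝ) • F i x‖ ^ p) μ :=
    fun ε => by
    simpa using integrable_norm_rpow_ofReal hp (memLp_sign_sum hF ε)
  unfold rademacherMoment
  rw [integral_const_mul, integral_finsetSum _ fun ε _ => h ε]
  congr 1
  refine Finset.sum_congr rfl fun ε _ => ?_
  rw [lpNorm_ofReal_rpow hp (memLp_sign_sum hF ε)]
  simp

/-- `Lᵖ(μ, E)` has type `p` if `E` has, with constants independent of `μ`. -/
theorem exists_type_lpNorm {p : ℝ} (hp : 1 ≤ p) (hE : HasRademacherType E p) :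
    ∃ C : ℝ, ∀ (Ω : Type u) [MeasurableSpace Ω] (μ : Measure Ω) (n : ℕ) (F : Fin n → Ω → E),
      (∀ i, MemLp (F i) (ENNReal.ofReal p) μ) →
      ((2 ^ n)⁻¹ * ∑ ε : Fin n → ℤˣ,
        lpNorm (∑ i, ((ε i : ℤ) : ℝ) • F i) (ENNReal.ofReal p) μ ^ p) ^ (1 / p) ≤
      C * (∑ i, lpNorm (F i) (ENNReal.ofReal p) μ ^ p) ^ (1 / p) := by
  obtain ⟨C, hC⟩ := hE
  have hp0 : 0 < p := by linarith
  refine ⟨|C|, fun Ω _ μ n F hF => ?_⟩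
  have hpt : ∀ x, rademacherMoment p (fun i => F i x) ≤ |C| ^ p * ∑ i, ‖F i x‖ ^ p := by
    intro x
    have hS : 0 ≤ ∑ i, ‖F i x‖ ^ p := Finset.sum_nonneg fun _ _ => by positivity
    have h1 := (hC n fun i => F i x).trans
      (mul_le_mul_of_nonneg_right (le_abs_self C) (Real.rpow_nonneg hS _))
    have h2 := Real.rpow_le_rpow (Real.rpow_nonneg (rademacherMoment_nonneg _ _) _) h1 hp0.le
    rwa [Real.mul_rpow (abs_nonneg _) (Real.rpow_nonneg hS _), one_div,
      Real.rpow_inv_rpow (rademacherMoment_nonneg _ _) hp0.ne', Real.rpow_inv_rpow hS hp0.ne'] at h2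
  have hint := fun i => integrable_norm_rpow_ofReal hp (hF i)
  have h := integral_mono (integrable_rademacherMoment hp hF)
    ((integrable_finsetSum _ fun i _ => hint i).const_mul _) hpt
  rw [integral_rademacherMoment hp hF, integral_const_mul,
    integral_finsetSum _ fun i _ => hint i] at h
  simp only [← lpNorm_ofReal_rpow hp (hF _)] at h
  have h0 : 0 ≤ ∑ i, lpNorm (F i) (ENNReal.ofReal p) μ ^ p :=
    Finset.sum_nonneg fun _ _ => Real.rpow_nonneg lpNorm_nonneg _
  have h3 := Real.rpow_le_rpow (mul_nonneg (by positivity)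
    (Finset.sum_nonneg fun _ _ => Real.rpow_nonneg lpNorm_nonneg _)) h
    (by positivity : 0 ≤ 1 / p)
  rwa [Real.mul_rpow (by positivity) h0, ← Real.rpow_mul (abs_nonneg _), mul_one_div_cancel hp0.ne',
    Real.rpow_one] at h3

/-- `Lᵖ(μ, E)` has finite cotype `r ≥ p` if `E` has, with constants independent of `μ`. -/
theorem exists_cotype_lpNorm {p r : ℝ} (hp : 1 ≤ p) (hpr : p ≤ r)
    (hE : ∃ K : ℝ, ∀ (n : ℕ) (x : Fin n → E),
      (∑ i, ‖x i‖ ^ r) ^ (1 / r) ≤ K * rademacherMoment r x ^ (1 / r)) :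
    ∃ K : ℝ, ∀ (Ω : Type u) [MeasurableSpace Ω] (μ : Measure Ω) (n : ℕ) (F : Fin n → Ω → E),
      (∀ i, MemLp (F i) (ENNReal.ofReal p) μ) →
      (∑ i, lpNorm (F i) (ENNReal.ofReal p) μ ^ r) ^ (1 / r) ≤
      K * ((2 ^ n)⁻¹ * ∑ ε : Fin n → ℤˣ,
        lpNorm (∑ i, ((ε i : ℤ) : ℝ) • F i) (ENNReal.ofReal p) μ ^ r) ^ (1 / r) := by
  obtain ⟨K, hK⟩ := hE
  have hp0 : 0 < p := by linarith
  have hr0 : 0 < r := by linarith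
  obtain ⟨D, hD0, hD⟩ := kahane_inequality.{v} hp hr0
  refine ⟨|K| * D, fun Ω _ μ n F hF => ?_⟩
  set c := |K| * D
  have hc : 0 ≤ c := by positivity
  -- Kahane turns the `r`-th moment into the `p`-th, whose integral is computable. Minkowski with
  -- exponent `r / p ≥ 1` then takes the sum out of the integral, and power means restore the
  -- exponent `r` at the end.
  have hpt : ∀ x, (∑ i, (‖F i x‖ ^ p) ^ (r / p)) ^ (1 / (r / p)) ≤
      c ^ p * rademacherMoment p fun i => F i x := by
    intro x
    have hM := rademacherMoment_nonneg p fun i => F i x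
    have hMr := rademacherMoment_nonneg r fun i => F i x
    have h1 : (∑ i, ‖F i x‖ ^ r) ^ (1 / r) ≤
        c * rademacherMoment p (fun i => F i x) ^ (1 / p) := by
      refine ((hK n fun i => F i x).trans
        (mul_le_mul_of_nonneg_right (le_abs_self K) (Real.rpow_nonneg hMr _))).trans ?_
      rw [mul_assoc]
      exact mul_le_mul_of_nonneg_left (hD E n _) (abs_nonneg _)
    have hS : 0 ≤ ∑ i, ‖F i x‖ ^ r := Finset.sum_nonneg fun _ _ => by positivity
    have h2 := Real.rpow_le_rpow (Real.rpow_nonneg hS _) h1 hp0.le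
    rw [Real.mul_rpow hc (Real.rpow_nonneg hM _), one_div p, Real.rpow_inv_rpow hM hp0.ne',
      ← Real.rpow_mul hS] at h2
    refine le_trans (le_of_eq ?_) h2
    congr 1
    · refine Finset.sum_congr rfl fun i _ => ?_
      rw [← Real.rpow_mul (norm_nonneg _), mul_div_cancel₀ _ hp0.ne']
    · rw [one_div_div, div_eq_inv_mul, one_div]
  have hs : 1 ≤ r / p := (one_le_div hp0).2 hpr
  have hint := fun i => integrable_norm_rpow_ofReal hp (hF i)
  have h := sum_integral_rpow_le hint (fun i x => by positivity) hs
  have h' := h.trans (integral_mono_of_nonneg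
    (Eventually.of_forall fun x => Real.rpow_nonneg (Finset.sum_nonneg fun _ _ => by positivity) _)
    ((integrable_rademacherMoment hp hF).const_mul _) (Eventually.of_forall hpt))
  rw [integral_const_mul, integral_rademacherMoment hp hF] at h'
  simp only [← lpNorm_ofReal_rpow hp (hF _), ← Real.rpow_mul lpNorm_nonneg,
    mul_div_cancel₀ _ hp0.ne'] at h'
  have h0 : 0 ≤ ∑ i, lpNorm (F i) (ENNReal.ofReal p) μ ^ r :=
    Finset.sum_nonneg fun _ _ => Real.rpow_nonneg lpNorm_nonneg _
  have h3 := Real.rpow_le_rpow (Real.rpow_nonneg h0 _) h' (by positivity : 0 ≤ 1 / p)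
  have e : 1 / (r / p) * (1 / p) = 1 / r := by
    field_simp
  rw [← Real.rpow_mul h0, e, Real.mul_rpow (by positivity) (mul_nonneg (by positivity)
    (Finset.sum_nonneg fun _ _ => Real.rpow_nonneg lpNorm_nonneg _)), ← Real.rpow_mul hc,
    mul_one_div_cancel hp0.ne', Real.rpow_one] at h3
  exact h3.trans (mul_le_mul_of_nonneg_left
    (signMean_rpow_mono (fun _ => lpNorm_nonneg) hp0 hpr) hc)

end LpSpaces

/-! ### Completion of a seminormed space: type, cotype and isometric actions. -/

section Completion

open UniformSpace

/-- The vector space `W` endowed with the seminorm `N`. -/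
def WithSeminorm {W : Type*} [AddCommGroup W] [Module ℝ W] (_N : Seminorm ℝ W) : Type _ := W

noncomputable instance {W : Type*} [AddCommGroup W] [Module ℝ W] (N : Seminorm ℝ W) :
    SeminormedAddCommGroup (WithSeminorm N) :=
  N.toAddGroupSeminorm.toSeminormedAddCommGroup

noncomputable instance {W : Type*} [AddCommGroup W] [Module ℝ W] (N : Seminorm ℝ W) :
    NormedSpace ℝ (WithSeminorm N) :=
  { (inferInstance : Module ℝ W) with
    norm_smul_le := fun a w => (map_smul_eq_mul N a w).le }

variable {W : Type*} [SeminormedAddCommGroup W] [NormedSpace ℝ W]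

/-- Type and cotype inequalities are closed conditions on a tuple, so they need checking only on
tuples from `W`. -/
theorem denseRange_pi_coe_completion {W : Type*} [SeminormedAddCommGroup W] (n : ℕ) :
    DenseRange fun (x : Fin n → W) (i : Fin n) => (x i : Completion W) :=
  DenseRange.piMap fun _ => Completion.denseRange_coe

theorem norm_sign_sum_coe {n : ℕ} (x : Fin n → W) (ε : Fin n → ℤˣ) :
    ‖∑ i, ((ε i : ℤ) : ℝ) • (x i : Completion W)‖ = ‖∑ i, ((ε i : ℤ) : ℝ) • x i‖ := by
  have h := map_sum (Completion.toComplL : W →L[ℝ] Completion W)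
    (fun i => ((ε i : ℤ) : ℝ) • x i) Finset.univ
  simp only [map_smul, Completion.coe_toComplL] at h
  rw [← h, Completion.norm_coe]

theorem continuous_rademacherMoment {X : Type*} [NormedAddCommGroup X] [NormedSpace ℝ X] {r : ℝ}
    (hr : 0 ≤ r) (n : ℕ) : Continuous fun x : Fin n → X => rademacherMoment r x := by
  refine continuous_const.mul (continuous_finsetSum _ fun ε _ => ?_)
  refine Continuous.rpow_const ?_ fun _ => Or.inr hr
  fun_prop

theorem continuous_sum_norm_rpow {X : Type*} [NormedAddCommGroup X] {r : ℝ}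
    (hr : 0 ≤ r) (n : ℕ) : Continuous fun x : Fin n → X => ∑ i, ‖x i‖ ^ r :=
  continuous_finsetSum _ fun i _ =>
    Continuous.rpow_const (by fun_prop) fun _ => Or.inr hr

theorem hasRademacherType_completion {p : ℝ} (hp : 0 ≤ p) {C : ℝ}
    (h : ∀ (n : ℕ) (x : Fin n → W),
      ((2 ^ n)⁻¹ * ∑ ε : Fin n → ℤˣ, ‖∑ i, ((ε i : ℤ) : ℝ) • x i‖ ^ p) ^ (1 / p) ≤
        C * (∑ i, ‖x i‖ ^ p) ^ (1 / p)) :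
    HasRademacherType (Completion W) p := by
  refine ⟨C, fun n x => ?_⟩
  have hp' : 0 ≤ 1 / p := by positivity
  refine (denseRange_pi_coe_completion n).induction_on
    (p := fun x => rademacherMoment p x ^ (1 / p) ≤ C * (∑ i, ‖x i‖ ^ p) ^ (1 / p)) x ?_ ?_
  · exact isClosed_le ((continuous_rademacherMoment hp n).rpow_const fun _ => Or.inr hp')
      (continuous_const.mul ((continuous_sum_norm_rpow hp n).rpow_const fun _ => Or.inr hp'))
  · intro y
    simpa only [rademacherMoment, norm_sign_sum_coe, Completion.norm_coe] using h n y

theorem exists_cotype_completion {r : ℝ} (hr : 0 ≤ r) {K : ℝ}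
    (h : ∀ (n : ℕ) (x : Fin n → W), (∑ i, ‖x i‖ ^ r) ^ (1 / r) ≤
      K * ((2 ^ n)⁻¹ * ∑ ε : Fin n → ℤˣ, ‖∑ i, ((ε i : ℤ) : ℝ) • x i‖ ^ r) ^ (1 / r)) :
    ∃ K : ℝ, ∀ (n : ℕ) (x : Fin n → Completion W),
      (∑ i, ‖x i‖ ^ r) ^ (1 / r) ≤ K * rademacherMoment r x ^ (1 / r) := by
  refine ⟨K, fun n x => ?_⟩
  have hr' : 0 ≤ 1 / r := by positivity
  refine (denseRange_pi_coe_completion n).induction_on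
    (p := fun x => (∑ i, ‖x i‖ ^ r) ^ (1 / r) ≤ K * rademacherMoment r x ^ (1 / r)) x ?_ ?_
  · exact isClosed_le ((continuous_sum_norm_rpow hr n).rpow_const fun _ => Or.inr hr')
      (continuous_const.mul ((continuous_rademacherMoment hr n).rpow_const fun _ => Or.inr hr'))
  · intro y
    simpa only [rademacherMoment, norm_sign_sum_coe, Completion.norm_coe] using h n y

/-- An action by isometries on a seminormed space induces an action by affine isometries on its
completion. -/
theorem exists_affineAction_completion {G : Type*} [Group G] (a : G → W → W)
    (hiso : ∀ g, Isometry (a g)) (h1 : ∀ w, a 1 w = w)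
    (hmul : ∀ g h w, a (g * h) w = a g (a h w)) :
    ∃ α : G →* (Completion W ≃ᵃⁱ[ℝ] Completion W),
      ∀ g (w : W), α g (w : Completion W) = (a g w : Completion W) := by
  have hc : ∀ g h, Completion.map (a (g * h)) = Completion.map (a g) ∘ Completion.map (a h) := by
    intro g h
    rw [Completion.map_comp (hiso g).uniformContinuous (hiso h).uniformContinuous]
    congr 1
    funext w
    exact hmul g h w
  have hid : Completion.map (a 1) = id := by
    rw [show a 1 = id from funext h1, Completion.map_id]
  let e : G → (Completion W ≃ᵢ Completion W) := fun g =>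
    { toFun := Completion.map (a g)
      invFun := Completion.map (a g⁻¹)
      left_inv := fun x => by
        have := congrFun (hc g⁻¹ g) x
        rw [inv_mul_cancel, hid] at this
        exact this.symm
      right_inv := fun x => by
        have := congrFun (hc g g⁻¹) x
        rw [mul_inv_cancel, hid] at this
        exact this.symm
      isometry_toFun := (hiso g).completion_map }
  -- Mazur–Ulam: a surjective isometry of a real normed space is affine, so the maps `a g` need not
  -- be assumed affine.
  have he : ∀ g x, (e g).toRealAffineIsometryEquiv x = Completion.map (a g) x := fun g x => by
    rw [IsometryEquiv.coeFn_toRealAffineIsometryEquiv]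
    rfl
  refine ⟨⟨⟨fun g => (e g).toRealAffineIsometryEquiv, ?_⟩, ?_⟩, ?_⟩
  · ext x
    rw [he, hid]
    rfl
  · intro g h
    ext x
    rw [AffineIsometryEquiv.coe_mul, Function.comp_apply, he, he, he, hc]
    rfl
  · intro g w
    refine (he g w).trans ?_
    rw [Completion.map_coe (hiso g).uniformContinuous]

end Completion

/-! ### Ultralimits of seminorms. -/

section Ultralimit

/-- A pointwise bounded sequence of seminorms has a limit along every ultrafilter. -/
theorem exists_seminorm_ultralimit {W : Type*} [AddCommGroup W] [Module ℝ W]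
    (U : Ultrafilter ℕ) (N : ℕ → Seminorm ℝ W) (hN : ∀ w, ∃ B, ∀ n, N n w ≤ B) :
    ∃ L : Seminorm ℝ W, ∀ w, Tendsto (fun n => N n w) U (𝓝 (L w)) := by
  have h : ∀ w, ∃ l, Tendsto (fun n => N n w) U (𝓝 l) := by
    intro w
    obtain ⟨B, hB⟩ := hN w
    obtain ⟨l, -, hl⟩ := (isCompact_Icc (a := (0 : ℝ)) (b := B)).ultrafilter_le_nhds
      (U.map fun n => N n w) (by
        rw [Ultrafilter.coe_map, le_principal_iff]
        exact mem_map.2 (univ_mem' fun n => ⟨apply_nonneg _ _, hB n⟩))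
    exact ⟨l, hl⟩
  choose L hL using h
  refine ⟨Seminorm.of L (fun x y => ?_) (fun a x => ?_), hL⟩
  · exact le_of_tendsto_of_tendsto' (hL _) ((hL x).add (hL y)) fun n => map_add_le_add _ _ _
  · refine tendsto_nhds_unique (hL _) ?_
    simpa only [map_smul_eq_mul] using (hL x).const_mul ‖a‖

theorem type_inequality_of_tendsto {W : Type*} [AddCommGroup W] [Module ℝ W]
    {l : Filter ℕ} [l.NeBot] {N : ℕ → Seminorm ℝ W} {L : Seminorm ℝ W}
    (hL : ∀ w, Tendsto (fun n => N n w) l (𝓝 (L w))) {p C : ℝ} (hp : 0 ≤ p) {m : ℕ} (x : Fin m → W)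
    (h : ∀ k, ((2 ^ m)⁻¹ * ∑ ε : Fin m → ℤˣ, N k (∑ i, ((ε i : ℤ) : ℝ) • x i) ^ p) ^ (1 / p) ≤
        C * (∑ i, N k (x i) ^ p) ^ (1 / p)) :
    ((2 ^ m)⁻¹ * ∑ ε : Fin m → ℤˣ, L (∑ i, ((ε i : ℤ) : ℝ) • x i) ^ p) ^ (1 / p) ≤
      C * (∑ i, L (x i) ^ p) ^ (1 / p) := by
  have hp' : 0 ≤ 1 / p := by positivity
  refine le_of_tendsto_of_tendsto' (b := l) ?_ ?_ h
  · exact ((tendsto_finsetSum _ fun ε _ => (hL _).rpow_const (Or.inr hp)).const_mul _).rpow_const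
      (Or.inr hp')
  · exact ((tendsto_finsetSum _ fun i _ => (hL _).rpow_const (Or.inr hp)).rpow_const
      (Or.inr hp')).const_mul _

theorem cotype_inequality_of_tendsto {W : Type*} [AddCommGroup W] [Module ℝ W]
    {l : Filter ℕ} [l.NeBot] {N : ℕ → Seminorm ℝ W} {L : Seminorm ℝ W}
    (hL : ∀ w, Tendsto (fun n => N n w) l (𝓝 (L w))) {r K : ℝ} (hr : 0 ≤ r) {m : ℕ} (x : Fin m → W)
    (h : ∀ k, (∑ i, N k (x i) ^ r) ^ (1 / r) ≤
      K * ((2 ^ m)⁻¹ * ∑ ε : Fin m → ℤˣ, N k (∑ i, ((ε i : ℤ) : ℝ) • x i) ^ r) ^ (1 / r)) :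
    (∑ i, L (x i) ^ r) ^ (1 / r) ≤
      K * ((2 ^ m)⁻¹ * ∑ ε : Fin m → ℤˣ, L (∑ i, ((ε i : ℤ) : ℝ) • x i) ^ r) ^ (1 / r) := by
  have hr' : 0 ≤ 1 / r := by positivity
  refine le_of_tendsto_of_tendsto' (b := l) ?_ ?_ h
  · exact (tendsto_finsetSum _ fun i _ => (hL _).rpow_const (Or.inr hr)).rpow_const (Or.inr hr')
  · exact (((tendsto_finsetSum _ fun ε _ => (hL _).rpow_const (Or.inr hr)).const_mul _).rpow_const
      (Or.inr hr')).const_mul _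

end Ultralimit

/-! ### Haar measure on compact subgroups. -/

section HaarMeasure

open MeasureTheory

/-- A compact subgroup carries a probability measure invariant under its right translations. -/
theorem exists_rightInvariant_probabilityMeasure {G : Type u} [Group G] [TopologicalSpace G]
    [IsTopologicalGroup G] [MeasurableSpace G] [BorelSpace G] (K : Subgroup G)
    (hK : IsCompact (K : Set G)) :
    ∃ μ : Measure G, IsProbabilityMeasure μ ∧ ∀ h ∈ K, μ.map (· * h) = μ := by
  have : CompactSpace K := isCompact_iff_compactSpace.1 hK
  have : BorelSpace K := Subtype.borelSpace _
  -- Inversion turns left invariance into right invariance; the normalisation at `⊤` gives total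
  -- mass one.
  let ν : Measure K := (Measure.haarMeasure ⊤).inv
  have hν : IsProbabilityMeasure ν := by
    constructor
    rw [Measure.inv_apply, Set.inv_univ]
    exact Measure.haarMeasure_self
  have hm : Measurable ((↑) : K → G) := measurable_subtype_coe
  refine ⟨ν.map (↑), Measure.isProbabilityMeasure_map hm.aemeasurable, fun h hh => ?_⟩
  have e : (· * h) ∘ ((↑) : K → G) = (↑) ∘ fun k : K => k * ⟨h, hh⟩ := rfl
  rw [Measure.map_map (measurable_mul_const h) hm, e, ← Measure.map_map hm (measurable_mul_const _),
    map_mul_right_eq_self]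

end HaarMeasure

/-! ### The invariant seminorm on bounded, uniformly continuous functions. -/

section InvariantSeminorm

open MeasureTheory

/-- The space of bounded functions `F : G → E` such that `F (x u)` tends to `F x` uniformly in `x`
as `u → 1`. -/
def boundedUniform (G : Type*) [Group G] [TopologicalSpace G] (E : Type*) [NormedAddCommGroup E]
    [NormedSpace ℝ E] : Submodule ℝ (G → E) where
  carrier := {F | (∃ B : ℝ, ∀ x, ‖F x‖ ≤ B) ∧
    ∀ ε > (0 : ℝ), ∀ᶠ u in 𝓝 (1 : G), ∀ x, ‖F (x * u) - F x‖ ≤ ε}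
  add_mem' := by
    rintro F F' ⟨⟨B, hB⟩, hF⟩ ⟨⟨B', hB'⟩, hF'⟩
    refine ⟨⟨B + B', fun x => norm_add_le_of_le (hB x) (hB' x)⟩, fun ε hε => ?_⟩
    filter_upwards [hF _ (half_pos hε), hF' _ (half_pos hε)] with u h h' x
    rw [Pi.add_apply, Pi.add_apply, add_sub_add_comm]
    linarith [norm_add_le_of_le (h x) (h' x)]
  zero_mem' := ⟨⟨0, by simp⟩, fun ε hε => by simp [hε.le]⟩
  smul_mem' := by
    rintro a F ⟨⟨B, hB⟩, hF⟩
    refine ⟨⟨‖a‖ * B, fun x => ?_⟩, fun ε hε => ?_⟩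
    · rw [Pi.smul_apply, norm_smul]
      exact mul_le_mul_of_nonneg_left (hB x) (norm_nonneg a)
    · have ha : 0 < ‖a‖ + 1 := by positivity
      filter_upwards [hF (ε / (‖a‖ + 1)) (by positivity)] with u h x
      rw [Pi.smul_apply, Pi.smul_apply, ← smul_sub, norm_smul]
      have h1 := h x
      rw [le_div_iff₀ ha] at h1
      nlinarith [norm_nonneg a, norm_nonneg (F (x * u) - F x)]

theorem lpNorm_le_of_norm_le {Ω E : Type*} [NormedAddCommGroup E] [MeasurableSpace Ω]
    {μ : Measure Ω} [IsProbabilityMeasure μ] {p : ℝ≥0∞}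
    (hp : 1 ≤ p) {F : Ω → E} {B : ℝ} (hB : ∀ x, ‖F x‖ ≤ B) : lpNorm F p μ ≤ B := by
  have hB0 : 0 ≤ B := (norm_nonneg _).trans (hB (Classical.choice μ.nonempty_of_neZero))
  refine (lpNorm_mono_real (memLp_const B) hB).trans_eq ?_
  rw [lpNorm_const (by positivity) (NeZero.ne μ)]
  simp [abs_of_nonneg hB0]

theorem le_lpNorm_of_le_norm {Ω E : Type*} [NormedAddCommGroup E] [MeasurableSpace Ω]
    {μ : Measure Ω} [IsProbabilityMeasure μ] {p : ℝ≥0∞}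
    (hp : 1 ≤ p) {F : Ω → E} (hF : MemLp F p μ) {B : ℝ} (hB : ∀ x, B ≤ ‖F x‖) :
    B ≤ lpNorm F p μ := by
  rcases lt_or_ge B 0 with h | h
  · exact h.le.trans lpNorm_nonneg
  · have h1 : lpNorm (fun _ : Ω => B) p μ ≤ lpNorm (fun x => ‖F x‖) p μ :=
      lpNorm_mono_real hF.norm fun x => by simpa [abs_of_nonneg h] using hB x
    rw [lpNorm_norm hF.aestronglyMeasurable, lpNorm_const (by positivity) (NeZero.ne μ)] at h1
    simpa [abs_of_nonneg h] using h1

variable {G : Type u} [Group G] [TopologicalSpace G] [IsTopologicalGroup G]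
  {E : Type v} [NormedAddCommGroup E] [NormedSpace ℝ E]

theorem continuous_of_mem_boundedUniform {F : G → E} (hF : F ∈ boundedUniform G E) :
    Continuous F := by
  rw [continuous_iff_continuousAt]
  intro x
  rw [ContinuousAt, ← map_mul_left_nhds_one, tendsto_map'_iff, Metric.tendsto_nhds]
  intro ε hε
  filter_upwards [hF.2 (ε / 2) (half_pos hε)] with u hu
  rw [Function.comp_apply, dist_eq_norm]
  exact (hu x).trans_lt (half_lt_self hε)

/-- Uniform continuity survives right translation because `x * u * h = (x * h) * (h⁻¹ * u * h)`. -/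
theorem tendsto_conj_one (h : G) : Tendsto (fun u => h⁻¹ * u * h) (𝓝 1) (𝓝 1) := by
  have : Continuous fun u : G => h⁻¹ * u * h := by fun_prop
  simpa using this.tendsto 1

/-- Right translation of functions on `G`. -/
def rightTranslation (h : G) : boundedUniform G E →ₗ[ℝ] boundedUniform G E :=
  (LinearMap.funLeft ℝ E (· * h)).restrict fun F hF => by
    obtain ⟨⟨B, hB⟩, hF⟩ := hF
    refine ⟨⟨B, fun x => hB _⟩, fun ε hε => ?_⟩
    filter_upwards [(tendsto_conj_one h).eventually (hF ε hε)] with u hu x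
    simpa [LinearMap.funLeft_apply, mul_assoc] using hu (x * h)

@[simp]
theorem rightTranslation_apply (h : G) (F : boundedUniform G E) (x : G) :
    (rightTranslation h F : G → E) x = (F : G → E) (x * h) := rfl

theorem memLp_of_mem_boundedUniform [SecondCountableTopology G] [MeasurableSpace G] [BorelSpace G]
    (μ : Measure G) [IsProbabilityMeasure μ] (p : ℝ≥0∞) (F : boundedUniform G E) :
    MemLp (F : G → E) p μ := by
  obtain ⟨B, hB⟩ := F.2.1
  exact MemLp.of_bound (continuous_of_mem_boundedUniform F.2).aestronglyMeasurable B
    (Eventually.of_forall hB)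

/-- The `Lᵖ(μ)`-seminorm on the space `boundedUniform G E`. -/
noncomputable def lpSeminorm [SecondCountableTopology G] [MeasurableSpace G] [BorelSpace G]
    (E : Type v) [NormedAddCommGroup E] [NormedSpace ℝ E]
    (μ : Measure G) [IsProbabilityMeasure μ] (p : ℝ≥0∞) (hp : 1 ≤ p) :
    Seminorm ℝ (boundedUniform G E) :=
  Seminorm.of (fun F => lpNorm (F : G → E) p μ)
    (fun F _ => lpNorm_add_le (memLp_of_mem_boundedUniform μ p F) hp)
    (fun a F => lpNorm_const_smul a (F : G → E) μ)

/-- An ultralimit of `Lᵖ`-seminorms with respect to Haar measures along a chain of compact subgroups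
with dense union is a translation invariant seminorm inheriting type `p` and cotype `q`. -/
theorem exists_invariant_seminorm [SecondCountableTopology G] (hG : IsApproximatelyCompact G)
    {p : ℝ} {q : ℝ≥0∞} (hp₁ : 1 ≤ p) (hp₂ : p ≤ 2) (hq : 2 ≤ q)
    (hEp : HasRademacherType E p) (hEq : HasRademacherCotype E q) :
    ∃ N : Seminorm ℝ (boundedUniform G E),
      (∀ (F : boundedUniform G E) (B : ℝ), (∀ x, ‖(F : G → E) x‖ ≤ B) → N F ≤ B) ∧
      (∀ (F : boundedUniform G E) (B : ℝ), (∀ x, B ≤ ‖(F : G → E) x‖) → B ≤ N F) ∧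
      (∀ h F, N (rightTranslation h F) = N F) ∧
      HasRademacherType (UniformSpace.Completion (WithSeminorm N)) p ∧
      HasRademacherCotype (UniformSpace.Completion (WithSeminorm N)) q := by
  obtain ⟨K, hKmono, hKc, hKd⟩ := hG
  let : MeasurableSpace G := borel G
  have : BorelSpace G := ⟨rfl⟩
  choose μ hμ hμinv using fun n => exists_rightInvariant_probabilityMeasure (K n) (hKc n)
  set P := ENNReal.ofReal p
  have hP : 1 ≤ P := by simpa [P] using hp₁
  have hp0 : 0 ≤ p := by linarith
  let M : ℕ → Seminorm ℝ (boundedUniform G E) := fun n => lpSeminorm E (μ n) P hP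
  have hM : ∀ n F, M n F = lpNorm (F : G → E) P (μ n) := fun _ _ => rfl
  obtain ⟨N, hN⟩ := exists_seminorm_ultralimit (hyperfilter ℕ) M (by
    intro F
    obtain ⟨B, hB⟩ := F.2.1
    exact ⟨B, fun n => lpNorm_le_of_norm_le hP hB⟩)
  have hle : ∀ (F : boundedUniform G E) (B : ℝ), (∀ x, ‖(F : G → E) x‖ ≤ B) → N F ≤ B :=
    fun F B hB => le_of_tendsto' (hN F) fun n => lpNorm_le_of_norm_le hP hB
  have hinv : ∀ n, ∀ h ∈ K n, ∀ F : boundedUniform G E, N (rightTranslation h F) = N F := by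
    intro n h hh F
    -- For `k ≥ n` the measure `μ k` is invariant under `K n`, so the two sequences of seminorms
    -- agree from `n` on.
    refine tendsto_nhds_unique (hN _) ((hN F).congr' ?_)
    refine Eventually.filter_mono Nat.hyperfilter_le_atTop ?_
    filter_upwards [eventually_ge_atTop n] with k hk
    have hF := continuous_of_mem_boundedUniform F.2
    have e : (rightTranslation h F : G → E) = (F : G → E) ∘ (· * h) := rfl
    rw [hM, hM, e, ← toReal_eLpNorm hF.aestronglyMeasurable,
      ← toReal_eLpNorm (hF.comp (continuous_mul_const h)).aestronglyMeasurable,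
      ← eLpNorm_map_measure hF.aestronglyMeasurable (measurable_mul_const h).aemeasurable,
      hμinv k h (hKmono hk hh)]
  refine ⟨N, hle, ?_, ?_, ?_, ?_⟩
  · exact fun F B hB => ge_of_tendsto' (hN F) fun n =>
      le_lpNorm_of_le_norm hP (memLp_of_mem_boundedUniform (μ n) P F) hB
  · intro h F
    refine eq_of_abs_sub_le_all fun ε hε => ?_
    -- A nearby `h'` in some `K n` moves `F` to within `ε` of `R_h F` in the supremum norm, which
    -- dominates `N`.
    have h1 : {h' | h⁻¹ * h' ∈ {u : G | ∀ x, ‖(F : G → E) (x * u) - (F : G → E) x‖ ≤ ε}} ∈ 𝓝 h := by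
      have : Continuous fun h' : G => h⁻¹ * h' := by fun_prop
      exact this.continuousAt.preimage_mem_nhds
        (by rw [inv_mul_cancel]; exact F.2.2 ε hε)
    obtain ⟨h', hh', hK'⟩ := hKd.inter_nhds_nonempty h1
    obtain ⟨n, hn⟩ := Set.mem_iUnion.1 hh'
    rw [← hinv n h' hn F]
    refine (abs_sub_map_le_sub N _ _).trans (hle _ _ fun x => ?_)
    have h2 := hK' (x * h)
    rw [norm_sub_rev] at h2
    simpa [mul_assoc] using h2
  · obtain ⟨C, hC⟩ := exists_type_lpNorm.{u} hp₁ hEp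
    refine hasRademacherType_completion hp0 (C := C) fun m (x : Fin m → boundedUniform G E) => ?_
    refine type_inequality_of_tendsto (W := boundedUniform G E) hN hp0 x fun k => ?_
    have := hC G (μ k) m (fun i => (x i : G → E))
      fun i => memLp_of_mem_boundedUniform (μ k) P _
    simpa [hM] using this
  · rcases hEq with hq' | hEq
    · exact Or.inl hq'
    rcases eq_or_ne q ⊤ with hq' | hq'
    · exact Or.inl hq'
    have hr : 2 ≤ q.toReal := by
      simpa using ENNReal.toReal_mono hq' hq
    obtain ⟨D, hD⟩ := exists_cotype_lpNorm.{u} hp₁ (hp₂.trans hr) hEq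
    refine Or.inr (exists_cotype_completion (by linarith) (K := D)
      fun m (x : Fin m → boundedUniform G E) => ?_)
    refine cotype_inequality_of_tendsto (W := boundedUniform G E) hN (by linarith) x fun k => ?_
    have := hD G (μ k) m (fun i => (x i : G → E))
      fun i => memLp_of_mem_boundedUniform (μ k) P _
    simpa [hM] using this

end InvariantSeminorm

/-! ### The affine action built from the coarse embedding. -/

section Main

variable {G : Type u} [Group G] [TopologicalSpace G]

/-- Right multiplication by `h` displaces every point equally; this makes all estimates on `σ (x *
h) - σ x` uniform in `x`. -/
theorem IsCompatibleLeftInvariant.dist_mul_right_eq {m : MetricSpace G}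
    (hm : IsCompatibleLeftInvariant m) (x h : G) : m.dist (x * h) x = m.dist h 1 := by
  simpa using hm.left_invariant x h 1

variable {E : Type v} [NormedAddCommGroup E]

theorem IsUCCoarseEmbeddingFor.eventually_norm_sub_le {m : MetricSpace G}
    (hm : IsCompatibleLeftInvariant m) {σ : G → E} (hσ : IsUCCoarseEmbeddingFor m σ) {ε : ℝ}
    (hε : 0 < ε) : ∀ᶠ u in 𝓝 (1 : G), ∀ x, ‖σ (x * u) - σ x‖ ≤ ε := by
  obtain ⟨δ, hδ, h⟩ := (@Metric.uniformContinuous_iff G E m.toPseudoMetricSpace _ _).1 hσ.1 ε hε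
  have h1 := @Metric.ball_mem_nhds G m.toPseudoMetricSpace 1 δ hδ
  rw [hm.compatible] at h1
  filter_upwards [h1] with u hu x
  rw [← dist_eq_norm]
  exact (h ((hm.dist_mul_right_eq x u).trans_lt hu)).le

theorem IsUCCoarseEmbeddingFor.exists_norm_sub_le {m : MetricSpace G}
    (hm : IsCompatibleLeftInvariant m) {σ : G → E} (hσ : IsUCCoarseEmbeddingFor m σ) (h : G) :
    ∃ B : ℝ, ∀ x, ‖σ (x * h) - σ x‖ ≤ B := by
  let := m
  have hfin := hσ.2.2 (nndist h 1)
  refine ⟨(expansionModulus σ (nndist h 1)).toReal, fun x => ?_⟩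
  rw [← dist_eq_norm, dist_edist]
  refine ENNReal.toReal_mono hfin.ne ?_
  refine le_iSup_of_le (x * h) (le_iSup_of_le x (le_iSup_of_le ?_ le_rfl))
  exact (NNReal.coe_le_coe.1 (hm.dist_mul_right_eq x h).le)

theorem IsUCCoarseEmbeddingFor.eventually_le_norm_sub {m : MetricSpace G}
    (hm : IsCompatibleLeftInvariant m) {σ : G → E} (hσ : IsUCCoarseEmbeddingFor m σ) {g : ℕ → G}
    (hg : Tendsto (fun n => m.dist (g n) 1) atTop atTop) (R : ℝ) :
    ∀ᶠ n in atTop, ∀ x, R ≤ ‖σ (x * g n) - σ x‖ := by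
  let := m
  have hexp := hσ.2.1
  unfold IsExpanding at hexp
  rw [ENNReal.tendsto_nhds_top_iff_nnreal] at hexp
  obtain ⟨t, ht⟩ := (hexp R.toNNReal).exists
  filter_upwards [hg.eventually_ge_atTop (t : ℝ)] with n hn x
  have h1 : compressionModulus σ t ≤ edist (σ (x * g n)) (σ x) :=
    iInf_le_of_le (x * g n) (iInf_le_of_le x (iInf_le_of_le
      (NNReal.coe_le_coe.1 (hn.trans_eq (hm.dist_mul_right_eq x (g n)).symm)) le_rfl))
  have h2 := ht.le.trans h1
  rw [edist_dist, dist_eq_norm] at h2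
  have h3 : ENNReal.ofReal R ≤ ENNReal.ofReal ‖σ (x * g n) - σ x‖ := h2
  exact (ENNReal.ofReal_le_ofReal_iff (norm_nonneg _)).1 h3

/-- An isometric action is continuous as soon as the orbit maps of a dense set of points are
continuous at the identity. -/
theorem isContinuousAffineAction_of_dense [IsTopologicalGroup G] {V : Type*} [NormedAddCommGroup V]
    [NormedSpace ℝ V] (α : G →* (V ≃ᵃⁱ[ℝ] V)) {D : Set V} (hD : Dense D)
    (h : ∀ w ∈ D, ∀ ε > (0 : ℝ), ∀ᶠ g in 𝓝 (1 : G), dist (α g w) w ≤ ε) :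
    IsContinuousAffineAction α := by
  refine continuous_iff_continuousAt.2 fun ⟨g, x⟩ => Metric.tendsto_nhds.2 fun ε hε => ?_
  obtain ⟨w, hw, hwx⟩ := Metric.dense_iff.1 hD x (ε / 5) (by positivity)
  rw [Metric.mem_ball] at hw
  have h1 : ∀ᶠ g' in 𝓝 g, dist (α (g⁻¹ * g') w) w ≤ ε / 5 := by
    have : Tendsto (fun g' : G => g⁻¹ * g') (𝓝 g) (𝓝 1) := by
      have hc : Continuous fun g' : G => g⁻¹ * g' := by fun_prop
      simpa using hc.tendsto g
    exact this.eventually (h w hwx (ε / 5) (by positivity))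
  have h2 : ∀ᶠ x' in 𝓝 x, dist x' x < ε / 5 := Metric.ball_mem_nhds x (by positivity)
  rw [nhds_prod_eq]
  filter_upwards [h1.prod_mk h2] with ⟨g', x'⟩ ⟨hg', hx'⟩
  simp only at hg' hx' ⊢
  have e1 : dist (α g' x') (α g' w) = dist x' w := (α g').dist_map _ _
  have e2 : dist (α g' w) (α g w) = dist (α (g⁻¹ * g') w) w := by
    have e : α g (α (g⁻¹ * g') w) = α g' w := by
      rw [← Function.comp_apply (f := α g), ← AffineIsometryEquiv.coe_mul, ← map_mul,
        mul_inv_cancel_left]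
    rw [← (α g).dist_map (α (g⁻¹ * g') w) w, e]
  have e3 : dist (α g w) (α g x) = dist w x := (α g).dist_map _ _
  have t1 := dist_triangle4 (α g' x') (α g' w) (α g w) (α g x)
  have t2 := dist_triangle x' x w
  rw [dist_comm x w] at t2
  linarith

/-- For an isometry, the displacements of `x` and of `0` differ by at most `2 * ‖x‖`. -/
theorem isMetricallyProperAffineAction_of_zero {V : Type*} [NormedAddCommGroup V]
    [NormedSpace ℝ V] (α : G →* (V ≃ᵃⁱ[ℝ] V))
    (h : ∀ g : ℕ → G, TendsToInfinity g → Tendsto (fun n => ‖α (g n) 0‖) atTop atTop) :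
    IsMetricallyProperAffineAction α := by
  intro x g hg
  refine tendsto_atTop_mono (fun n => ?_)
    (tendsto_atTop_add_const_right _ (-(2 * ‖x‖)) (h g hg))
  have e : dist (α (g n) 0) (α (g n) x) = ‖x‖ := by
    rw [(α (g n)).dist_map, dist_zero_left]
  have t := dist_triangle4 (α (g n) 0) (α (g n) x) x 0
  rw [dist_zero_right, dist_zero_right] at t
  linarith

end Main

theorem mainTheorem10 {G : Type u} [Group G] [TopologicalSpace G] [IsTopologicalGroup G]
    [TopologicalSpace.MetrizableSpace G] [TopologicalSpace.SeparableSpace G]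
    (hG : IsApproximatelyCompact G) (hOB : HasLocalOB G)
    (p : ℝ) (q : ℝ≥0∞) (hp₁ : 1 ≤ p) (hp₂ : p ≤ 2) (hq : 2 ≤ q)
    {E : Type v} [NormedAddCommGroup E] [NormedSpace ℝ E] [CompleteSpace E]
    (hEp : HasRademacherType E p) (hEq : HasRademacherCotype E q)
    (σ : G → E) (hσ : IsUCCoarseEmbedding σ) :
    ∃ (V : Type (max u v)) (_ : NormedAddCommGroup V) (_ : NormedSpace ℝ V),
      CompleteSpace V ∧ HasRademacherType V p ∧ HasRademacherCotype V q ∧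
        ∃ α : G →* (V ≃ᵃⁱ[ℝ] V),
          IsContinuousAffineAction α ∧ IsMetricallyProperAffineAction α := by
  obtain ⟨m, hm⟩ := exists_isMetricallyProperMetric hOB
  have hmc := hm.toIsCompatibleLeftInvariant
  have hσm := hσ m hm
  have : SecondCountableTopology G := by
    let := TopologicalSpace.metrizableSpaceMetric G
    exact UniformSpace.secondCountable_of_separable G
  obtain ⟨N, hNle, hNge, hNinv, hVp, hVq⟩ := exists_invariant_seminorm hG hp₁ hp₂ hq hEp hEq
  -- `σ` itself is in general unbounded, but its increments along `h` lie in the space.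
  have hb : ∀ h : G, (fun x => σ (x * h) - σ x) ∈ boundedUniform G E := by
    intro h
    refine ⟨hσm.exists_norm_sub_le hmc h, fun ε hε => ?_⟩
    have hev := fun ε hε => hσm.eventually_norm_sub_le hmc (ε := ε) hε
    filter_upwards [hev _ (half_pos hε), (tendsto_conj_one h).eventually (hev _ (half_pos hε))]
      with u h1 h2 x
    have h3 := h2 (x * h)
    rw [show x * h * (h⁻¹ * u * h) = x * u * h by group] at h3
    rw [sub_sub_sub_comm]
    linarith [norm_sub_le_of_le h3 (h1 x)]
  let b : G → boundedUniform G E := fun h => ⟨_, hb h⟩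
  let a : G → WithSeminorm N → WithSeminorm N := fun h (F : boundedUniform G E) =>
    rightTranslation h F + b h
  have hiso : ∀ h, Isometry (a h) := by
    refine fun h => Isometry.of_dist_eq fun F F' => ?_
    rw [dist_eq_norm, dist_eq_norm]
    have e : ∀ f f' : boundedUniform G E,
        rightTranslation h f + b h - (rightTranslation h f' + b h) =
        rightTranslation h (f - f') := fun f f' => by
      rw [map_sub, add_sub_add_right_eq_sub]
    exact (congrArg N (e F F')).trans (hNinv h _)
  have ha1 : ∀ F, a 1 F = F := by
    intro F
    refine Subtype.ext (funext fun x => ?_)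
    change (F : boundedUniform G E).1 (x * 1) + (σ (x * 1) - σ x) = (F : boundedUniform G E).1 x
    simp
  have hamul : ∀ g h F, a (g * h) F = a g (a h F) := by
    intro g h F
    refine Subtype.ext (funext fun x => ?_)
    change (F : boundedUniform G E).1 (x * (g * h)) + (σ (x * (g * h)) - σ x) =
      (F : boundedUniform G E).1 (x * g * h) + (σ (x * g * h) - σ (x * g)) + (σ (x * g) - σ x)
    rw [mul_assoc]
    abel
  obtain ⟨α, hα⟩ := exists_affineAction_completion a hiso ha1 hamul
  refine ⟨UniformSpace.Completion (WithSeminorm N), inferInstance, inferInstance, inferInstance,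
    hVp, hVq, α, ?_, ?_⟩
  · refine isContinuousAffineAction_of_dense α
      (UniformSpace.Completion.denseRange_coe (α := WithSeminorm N)) ?_
    rintro _ ⟨F, rfl⟩ ε hε
    filter_upwards [(F : boundedUniform G E).2.2 _ (half_pos hε),
      hσm.eventually_norm_sub_le hmc (half_pos hε)] with g h1 h2
    rw [hα, UniformSpace.Completion.dist_eq, dist_eq_norm]
    refine hNle _ _ fun x => ?_
    change ‖(F : boundedUniform G E).1 (x * g) + (σ (x * g) - σ x) -
      (F : boundedUniform G E).1 x‖ ≤ ε
    rw [add_sub_right_comm]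
    linarith [norm_add_le_of_le (h1 x) (h2 x)]
  · refine isMetricallyProperAffineAction_of_zero α fun g hg => tendsto_atTop.2 fun R => ?_
    -- The orbit of `0` is the cocycle `b`, and `‖b (g n) (x)‖ ≥ R` for every `x` gives the same
    -- lower bound for the seminorm.
    filter_upwards [hσm.eventually_le_norm_sub hmc (hm.metrically_proper g hg) R] with n hn
    rw [← UniformSpace.Completion.coe_zero, hα, UniformSpace.Completion.norm_coe]
    refine hNge _ _ fun x => ?_
    have e : a (g n) 0 = b (g n) := by
      change rightTranslation (g n) (0 : boundedUniform G E) + b (g n) = b (g n)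
      rw [map_zero, zero_add]
    rw [e]
    exact hn x
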